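/- Let $A$ be a unital AF algebra with a given representation $A=\overline{\bigcup_{k\in\mathbb N}A_k}$, where $A_0\subseteq A_1\subseteq\cdots$ are finite dimensional unital $C^*$-subalgebras (containing the unit of $A$), with inclusion maps $h_k:A_k\to A_{k+1}$. Let $\mathcal U$ be a countably incomplete ultrafilter on a set $I$ (for instance a free ultrafilter on $\mathbb N$), let $(B_i)_{i\in I}$ be finite dimensional unital $C^*$-algebras, let $\mathfrak B$ be the internal (set-theoretic) ultraproduct of the $B_i$, and let $B=\{(x_i)\in\prod_i B_i:\sup_i\|x_i\|<\infty\}/\{(x_i):\lim_{\mathcal U}\|x_i\|=0\}$ be its infinitesimal hull, i.e. the $C^*$-algebra ultraproduct of the $B_i$. For a finite dimensional $C^*$-algebra $F$ let $\min F$ be its set of minimal nonzero central projections, and let $\overline{\dim}\,F=(\dim e)_{e\in\min F}$, where $Fe\cong M_{\dim e}(\mathbb C)$. For a unital $*$-morphism $h:F\to G$ of finite dimensional $C^*$-algebras let $\Lambda(h)=(\Lambda_{fe})_{(f,e)\in\min G\times\min F}$, where $\Lambda_{fe}$ is the multiplicity of the irreducible representation of $F$ corresponding to $e$ in the representation $x\mapsto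 h(x)f$ of $F$ obtained by identifying $Gf$ with $M_{\dim f}(\mathbb C)$. Set $\overline{\dim}\,\mathfrak B=[\overline{\dim}\,B_i]_{\mathcal U}$. An internal matrix indexed by $\min\mathfrak B\times\min A_k$ is a class modulo $\mathcal U$ of families of matrices over $\mathbb Z_{\ge0}$ indexed by $\min B_i\times\min A_k$; it is a mapping matrix if, for $\mathcal U$-almost all $i$, every row of the $i$-th matrix has a nonzero entry. Products with the standard matrices and vectors of the $A_k$ are formed componentwise in $i$. A lifting of a unital $*$-morphism $\varphi:A\to B$ is an internal unital $*$-morphism $\Phi=[\Phi_i]_{\mathcal U}$, $\Phi_i:F_i\to B_i$ (defined for $\mathcal U$-almost all $i$), where the $F_i\subseteq A$ are finite dimensional unital $C^*$-subalgebras such that, for every $k$, $A_k\subseteq F_i$ for $\mathcal U$-almost all $i$, and such that $\varphi(x)$ is the class of $(\Phi_i(x))_i$ for all $x\in\bigcup_kA_k$. The matrix sequence $\Lambda_\Box(\varphi)$ is the sequence of internal matrices $\bigl([\Lambda(\Phi_i|_{A_k})]_{\mathcal U}\bigr)_{k\in\mathbb N}$ for a lifting $\Phi$ of $\varphi$. Two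 unital $*$-morphisms $\varphi,\psi:A\to B$ are inner conjugate if there is a unitary $u\in B$ with $\varphi(x)=u^*\psi(x)u$ for all $x\in A$. Then every unital $*$-morphism $\varphi:A\to B$ has a lifting, $\Lambda_\Box(\varphi)$ does not depend on the choice of the lifting and depends only on the inner conjugacy class of $\varphi$, and $\Lambda_\Box$ induces a bijection from the set of inner conjugacy classes of unital $*$-morphisms $A\to B$ onto the set of sequences $(\Gamma_k)_{k\in\mathbb N}$ of mapping matrices, with $\Gamma_k$ indexed by $\min\mathfrak B\times\min A_k$, such that for all $k$ $$\Gamma_k\,\overline{\dim}\,A_k=\overline{\dim}\,\mathfrak B\qquad\text{and}\qquad \Gamma_{k+1}\,\Lambda(h_k)=\Gamma_k .$$ -/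

import Mathlib

open Filter Topology
open scoped Matrix

noncomputable section

namespace AFUltra

/-! ### Finite dimensional C*-algebras: blocks, dimension vectors, mapping matrices -/

section Blocks

universe u v

variable (A : Type u) [Ring A] [StarRing A] [Algebra ℂ A]

/-- `e` is a minimal nonzero central projection of `A`; for projections `q * e = q` says
`q ≤ e`. -/
structure IsMinCentralProj {A : Type u} [Ring A] [StarRing A] (e : A) : Prop where
  isStarProjection : IsStarProjection e
  mem_center : e ∈ Set.center A
  ne_zero : e ≠ 0
  minimal : ∀ q : A, IsStarProjection q → q ∈ Set.center A → q * e = q → q = 0 ∨ q = e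

/-- The set `min A` of minimal nonzero central projections of `A`. -/
abbrev MinProj : Type u := {e : A // IsMinCentralProj e}

variable {A}

/-- A representation `ρ : A → M_n(ℂ)` which restricts to an isomorphism of the block `A e` onto
`M_n(ℂ)` and vanishes on `A (1 - e)`: the irreducible representation of `A` corresponding
to `e`. -/
def IsBlockRep (e : MinProj A) {n : ℕ} (ρ : A →⋆ₐ[ℂ] Matrix (Fin n) (Fin n) ℂ) : Prop :=
  Function.Surjective ρ ∧ ∀ x : A, ρ x = 0 ↔ x * e.1 = 0

variable (A) in
theorem nonempty_rep : Nonempty (Σ n : ℕ, A →⋆ₐ[ℂ] Matrix (Fin n) (Fin n) ℂ) :=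
  ⟨⟨0, { toFun := fun _ => 0
         map_one' := Subsingleton.elim _ _
         map_mul' := fun _ _ => Subsingleton.elim _ _
         map_zero' := rfl
         map_add' := fun _ _ => Subsingleton.elim _ _
         commutes' := fun _ => Subsingleton.elim _ _
         map_star' := fun _ => Subsingleton.elim _ _ }⟩⟩

/-- A choice of an irreducible representation of `A` corresponding to `e`, together with its
dimension. For a finite dimensional C*-algebra it exists and is unique up to unitary
equivalence. -/
def blockRep (e : MinProj A) : Σ n : ℕ, A →⋆ₐ[ℂ] Matrix (Fin n) (Fin n) ℂ :=
  @Classical.epsilon _ (nonempty_rep A) (fun p => IsBlockRep e p.2)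

variable (A) in
/-- The dimension vector of `A`: the size `dim e` of the matrix algebra `A e ≅ M_{dim e}(ℂ)`, for
`e ∈ min A`. -/
def dimVec : MinProj A → ℕ := fun e => (blockRep e).1

/-- The space of operators intertwining two matrix representations. -/
def intertwiners {n m : ℕ} (ρ : A →⋆ₐ[ℂ] Matrix (Fin n) (Fin n) ℂ)
    (σ : A →⋆ₐ[ℂ] Matrix (Fin m) (Fin m) ℂ) : Submodule ℂ (Matrix (Fin m) (Fin n) ℂ) where
  carrier := {T | ∀ x : A, σ x * T = T * ρ x}
  add_mem' := by
    intro S T hS hT x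
    rw [Matrix.mul_add, Matrix.add_mul, hS x, hT x]
  zero_mem' := by
    intro x
    rw [Matrix.mul_zero, Matrix.zero_mul]
  smul_mem' := by
    intro c T hT x
    rw [Matrix.mul_smul, Matrix.smul_mul, hT x]

/-- The multiplicity of the irreducible representation `ρ` in the representation `σ`. -/
def multiplicity {n m : ℕ} (ρ : A →⋆ₐ[ℂ] Matrix (Fin n) (Fin n) ℂ)
    (σ : A →⋆ₐ[ℂ] Matrix (Fin m) (Fin m) ℂ) : ℕ :=
  Module.finrank ℂ (intertwiners ρ σ)

/-- The mapping matrix `Λ(h)` of a unital morphism `h : A → B` of finite dimensional C*-algebras: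
`Λ(h) f e` is the multiplicity of the irreducible representation of `A` corresponding to `e` in
the representation `x ↦ h(x) f` of `A`, where `B f` is identified with a full matrix algebra. -/
def mappingMatrix {B : Type v} [Ring B] [StarRing B] [Algebra ℂ B] (h : A →⋆ₐ[ℂ] B) :
    Matrix (MinProj B) (MinProj A) ℕ :=
  Matrix.of fun f e => multiplicity (blockRep e).2 ((blockRep f).2.comp h)

/-- Every row has a nonzero entry. -/
def IsMappingMatrix {J : Type u} {I : Type v} (Γ : Matrix J I ℕ) : Prop :=
  ∀ f, ∃ e, 0 < Γ f e

theorem MinProj.mul_eq_zero {A : Type u} [Ring A] [StarRing A] {e f : MinProj A} (h : e ≠ f) : e.1 * f.1 = 0 := by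
  have hc : Commute e.1 f.1 := e.2.mem_center.comm f.1
  have hp : IsStarProjection (e.1 * f.1) :=
    e.2.isStarProjection.mul f.2.isStarProjection hc
  have hm : e.1 * f.1 ∈ Set.center A := Set.mul_mem_center e.2.mem_center f.2.mem_center
  have he : e.1 * f.1 * e.1 = e.1 * f.1 := by
    rw [mul_assoc, ← hc.eq, ← mul_assoc, e.2.isStarProjection.isIdempotentElem.eq]
  have hf : e.1 * f.1 * f.1 = e.1 * f.1 := by
    rw [mul_assoc, f.2.isStarProjection.isIdempotentElem.eq]
  rcases e.2.minimal _ hp hm he with h0 | h1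
  · exact h0
  rcases f.2.minimal _ hp hm hf with h0 | h2
  · exact h0
  · exact absurd (Subtype.ext (h1.symm.trans h2)) h

instance [FiniteDimensional ℂ A] : Finite (MinProj A) := by
  have hli : LinearIndependent ℂ (fun e : MinProj A => e.1) := by
    rw [linearIndependent_iff']
    intro s g hg e he
    have h1 : (∑ i ∈ s, g i • i.1) * e.1 = g e • e.1 := by
      rw [Finset.sum_mul, Finset.sum_eq_single e]
      · rw [smul_mul_assoc, e.2.isStarProjection.isIdempotentElem.eq]
      · intro f _ hfe
        rw [smul_mul_assoc, MinProj.mul_eq_zero hfe, smul_zero]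
      · intro h
        exact absurd he h
    rw [hg, zero_mul] at h1
    exact (smul_eq_zero.mp h1.symm).resolve_right e.2.ne_zero
  exact hli.finite

instance [FiniteDimensional ℂ A] : Fintype (MinProj A) := Fintype.ofFinite _

end Blocks

/-! ### Inner conjugacy -/

section InnerConj

universe u v

variable (A : Type u) [Ring A] [StarRing A] [Algebra ℂ A]
  (B : Type v) [Ring B] [StarRing B] [Algebra ℂ B]

/-- `φ` and `ψ` are inner conjugate: `φ(x) = u* ψ(x) u` for a unitary `u` of `B`. -/
def InnerConj {A : Type u} [Ring A] [StarRing A] [Algebra ℂ A]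
    {B : Type v} [Ring B] [StarRing B] [Algebra ℂ B] (φ ψ : A →⋆ₐ[ℂ] B) : Prop :=
  ∃ u ∈ unitary B, ∀ x : A, φ x = star u * ψ x * u

/-- Inner conjugacy of unital *-morphisms `A → B` as an equivalence relation. -/
def innerConjSetoid : Setoid (A →⋆ₐ[ℂ] B) where
  r := InnerConj
  iseqv :=
    { refl := fun φ => ⟨1, one_mem _, fun x => by simp⟩
      symm := by
        rintro φ ψ ⟨u, hu, h⟩
        refine ⟨star u, Unitary.star_mem hu, fun x => ?_⟩
        have h1 : u * star u = 1 := Unitary.mul_star_self_of_mem hu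
        calc ψ x = (u * star u) * ψ x * (u * star u) := by rw [h1, one_mul, mul_one]
          _ = star (star u) * φ x * star u := by rw [h x, star_star]; simp only [mul_assoc]
      trans := by
        rintro φ ψ χ ⟨u, hu, h⟩ ⟨w, hw, h'⟩
        refine ⟨w * u, mul_mem hw hu, fun x => ?_⟩
        rw [h x, h' x, star_mul]
        simp only [mul_assoc] }

end InnerConj

/-! ### Ultraproducts of sets -/

section SetUltraproduct

universe u v w

variable {I : Type u} {U : Ultrafilter I} {X : I → Type v} {Y : I → Type w}

/-- The internal function between set-theoretic ultraproducts defined by a family of functions. -/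
def internalMap (F : ∀ i, X i → Y i) :
    (U : Filter I).Product X → (U : Filter I).Product Y :=
  Quotient.map' (fun x i => F i (x i)) fun _ _ h => h.mono fun i hi => congrArg (F i) hi

/-- The internal predicate on a set-theoretic ultraproduct defined by a family of predicates. -/
def internalPred (P : ∀ i, X i → Prop) : (U : Filter I).Product X → Prop :=
  fun x => Quotient.liftOn' x (fun x => ∀ᶠ i in (U : Filter I), P i (x i)) fun _ _ h =>
    propext (eventually_congr (h.mono fun i hi => by rw [hi]))

/-- The class of a family in the set-theoretic ultraproduct. -/
def internalMk (U : Ultrafilter I) (x : ∀ i, X i) : (U : Filter I).Product X :=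
  Quotient.mk'' x

end SetUltraproduct

/-! ### Ultraproducts of C*-algebras -/

section Ultraproduct

universe u v

variable {I : Type u} (U : Ultrafilter I) (B : I → Type v) [∀ i, CStarAlgebra (B i)]

/-- The *-algebra of bounded families in `∏ i, B i`. -/
def boundedFamilies : StarSubalgebra ℂ (∀ i, B i) where
  carrier := {x | ∃ C : ℝ, ∀ i, ‖x i‖ ≤ C}
  mul_mem' := by
    rintro x y ⟨C, hC⟩ ⟨D, hD⟩
    refine ⟨C * D, fun i => (norm_mul_le _ _).trans ?_⟩
    exact mul_le_mul (hC i) (hD i) (norm_nonneg _) ((norm_nonneg _).trans (hC i))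
  add_mem' := by
    rintro x y ⟨C, hC⟩ ⟨D, hD⟩
    exact ⟨C + D, fun i => (norm_add_le _ _).trans (add_le_add (hC i) (hD i))⟩
  algebraMap_mem' := by
    intro c
    refine ⟨‖c‖, fun i => ?_⟩
    rw [Pi.algebraMap_apply, Algebra.algebraMap_eq_smul_one, norm_smul]
    refine mul_le_of_le_one_right (norm_nonneg _) ?_
    rcases subsingleton_or_nontrivial (B i) with h | h
    · rw [Subsingleton.elim (1 : B i) 0, norm_zero]
      exact zero_le_one
    · exact CStarRing.norm_one.le
  star_mem' := by
    rintro x ⟨C, hC⟩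
    exact ⟨C, fun i => by rw [Pi.star_apply, norm_star]; exact hC i⟩

/-- The ideal of bounded families whose norms tend to `0` along `U`. -/
def nullIdeal : Ideal (boundedFamilies B) where
  carrier := {x | Tendsto (fun i => ‖x.1 i‖) (U : Filter I) (𝓝 0)}
  zero_mem' := by simp
  add_mem' := by
    intro x y hx hy
    refine squeeze_zero (fun i => norm_nonneg _) (fun i => norm_add_le (x.1 i) (y.1 i)) ?_
    simpa using Tendsto.add hx hy
  smul_mem' := by
    rintro ⟨c, C, hC⟩ x hx
    refine squeeze_zero (fun i => norm_nonneg _) (fun i => ?_) (by simpa using hx.const_mul C)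
    exact (norm_mul_le (c i) (x.1 i)).trans
      (mul_le_mul_of_nonneg_right (hC i) (norm_nonneg _))

instance : (nullIdeal U B).IsTwoSided where
  mul_mem_of_left := by
    rintro x ⟨c, C, hC⟩ hx
    refine squeeze_zero (fun i => norm_nonneg _) (fun i => ?_) (by simpa using hx.mul_const C)
    exact (norm_mul_le (x.1 i) (c i)).trans
      (mul_le_mul_of_nonneg_left (hC i) (norm_nonneg _))

/-- The C*-algebra ultraproduct of the `B i` along `U`: bounded families modulo those whose norms
tend to `0` along `U`. It is the infinitesimal hull of the internal C*-algebra defined by the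
family `B`. -/
def Ultraproduct : Type (max u v) := boundedFamilies B ⧸ nullIdeal U B

instance : Ring (Ultraproduct U B) :=
  inferInstanceAs (Ring (boundedFamilies B ⧸ nullIdeal U B))

instance : Algebra ℂ (Ultraproduct U B) :=
  inferInstanceAs (Algebra ℂ (boundedFamilies B ⧸ nullIdeal U B))

/-- The quotient map from bounded families to the ultraproduct. -/
def Ultraproduct.mk : boundedFamilies B →ₐ[ℂ] Ultraproduct U B :=
  Ideal.Quotient.mkₐ ℂ (nullIdeal U B)

theorem Ultraproduct.mk_surjective : Function.Surjective (Ultraproduct.mk U B) :=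
  Ideal.Quotient.mk_surjective

theorem Ultraproduct.mk_eq_mk {x y : boundedFamilies B} :
    Ultraproduct.mk U B x = Ultraproduct.mk U B y ↔
      Tendsto (fun i => ‖x.1 i - y.1 i‖) (U : Filter I) (𝓝 0) :=
  Ideal.Quotient.mk_eq_mk_iff_sub_mem x y

instance : Star (Ultraproduct U B) where
  star := Quotient.map' (fun x : boundedFamilies B => star x) (by
    intro x y h
    have h' := (Ultraproduct.mk_eq_mk U B).mp (Quotient.sound' h)
    refine Quotient.exact' ((Ultraproduct.mk_eq_mk U B).mpr ?_)
    refine h'.congr fun i => ?_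
    have : (star x : boundedFamilies B).1 i - (star y : boundedFamilies B).1 i
      = star (x.1 i - y.1 i) := (star_sub _ _).symm
    rw [this, norm_star])

theorem Ultraproduct.star_mk (x : boundedFamilies B) :
    star (Ultraproduct.mk U B x) = Ultraproduct.mk U B (star x) := rfl

instance : StarRing (Ultraproduct U B) where
  star_involutive := by
    intro a
    obtain ⟨x, rfl⟩ := Ultraproduct.mk_surjective U B a
    rw [Ultraproduct.star_mk, Ultraproduct.star_mk, star_star]
  star_mul := by
    intro a b
    obtain ⟨x, rfl⟩ := Ultraproduct.mk_surjective U B a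
    obtain ⟨y, rfl⟩ := Ultraproduct.mk_surjective U B b
    rw [← map_mul, Ultraproduct.star_mk, star_mul, map_mul, Ultraproduct.star_mk,
      Ultraproduct.star_mk]
  star_add := by
    intro a b
    obtain ⟨x, rfl⟩ := Ultraproduct.mk_surjective U B a
    obtain ⟨y, rfl⟩ := Ultraproduct.mk_surjective U B b
    rw [← map_add, Ultraproduct.star_mk, star_add, map_add, Ultraproduct.star_mk,
      Ultraproduct.star_mk]

end Ultraproduct

/-! ### Liftings and matrix sequences -/

section MatrixSequence

universe u v w

variable {A : Type u} [CStarAlgebra A] (𝒜 : ℕ → StarSubalgebra ℂ A)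
  {I : Type v} (U : Ultrafilter I) (B : I → Type w) [∀ i, CStarAlgebra (B i)]

/-- A sequence of internal matrices of nonnegative hyperintegers, the `k`-th of which is indexed
by `min 𝔅 × min (𝒜 k)`, where `𝔅` is the internal algebra defined by the family `B`. -/
abbrev InternalMatrixSeq : Type _ :=
  ∀ k, (U : Filter I).Product fun i => Matrix (MinProj (B i)) (MinProj (𝒜 k)) ℕ

variable {U B}

/-- An internal lifting of `φ`: an internal morphism `Φ : 𝔄 → 𝔅`, where `𝔄` is a hyperfinite
dimensional internal subalgebra of the ultrapower of `A` which contains (the ultrapowers of) all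
`𝒜 k`, such that `Φ` induces `φ` on every `𝒜 k`. Being internal, `𝔄` and `Φ` are given by families
`alg i` and `hom i`, where `i` ranges over a set in `U`. -/
structure Lifting (φ : A →⋆ₐ[ℂ] Ultraproduct U B) where
  /-- The indices at which the family is defined. -/
  support : Set I
  support_mem : support ∈ U
  /-- The internal subalgebra `𝔄`. -/
  alg : I → StarSubalgebra ℂ A
  finiteDimensional : ∀ i ∈ support, FiniteDimensional ℂ (alg i)
  le_alg : ∀ k, ∀ᶠ i in (U : Filter I), 𝒜 k ≤ alg i
  /-- The internal morphism `Φ`. -/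
  hom : ∀ i ∈ support, alg i →⋆ₐ[ℂ] B i
  lifts : ∀ k, ∀ x ∈ 𝒜 k, ∃ y : boundedFamilies B, φ x = Ultraproduct.mk U B y ∧
    ∀ᶠ i in (U : Filter I), ∃ (hi : i ∈ support) (hx : x ∈ alg i), hom i hi ⟨x, hx⟩ = y.1 i

variable {𝒜}

open Classical in
/-- The sequence of internal mapping matrices of the restrictions of a lifting to the `𝒜 k`. -/
def Lifting.matrixSeq {φ : A →⋆ₐ[ℂ] Ultraproduct U B} (Φ : Lifting 𝒜 φ) :
    InternalMatrixSeq 𝒜 U B := fun k =>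
  internalMk U fun i =>
    if h : i ∈ Φ.support ∧ 𝒜 k ≤ Φ.alg i then
      mappingMatrix ((Φ.hom i h.1).comp (StarSubalgebra.inclusion h.2))
    else 0

variable (𝒜) in
/-- `Γ` is the matrix sequence of `φ`, that is, the sequence of mapping matrices of the restrictions
to the `𝒜 k` of a lifting of `φ`. -/
def IsMatrixSeq (φ : A →⋆ₐ[ℂ] Ultraproduct U B) (Γ : InternalMatrixSeq 𝒜 U B) : Prop :=
  ∃ Φ : Lifting 𝒜 φ, Φ.matrixSeq = Γ

variable (𝒜) in
/-- `Γ` is a sequence of (internal) mapping matrices with `Γ_k · dim (𝒜 k) = dim 𝔅` and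
`Γ_{k+1} · Λ(h_k) = Γ_k`, where `h_k : 𝒜 k → 𝒜 (k + 1)` is the inclusion. -/
structure IsCompatible [∀ k, FiniteDimensional ℂ (𝒜 k)] (h𝒜 : Monotone 𝒜)
    (Γ : InternalMatrixSeq 𝒜 U B) : Prop where
  isMappingMatrix : ∀ k, internalPred (fun _ M => IsMappingMatrix M) (Γ k)
  mul_dim : ∀ k, internalMap (fun _ M => M *ᵥ dimVec (𝒜 k)) (Γ k) =
    internalMk U fun i => dimVec (B i)
  mul_inclusion : ∀ k,
    internalMap
      (fun _ M => M * mappingMatrix (StarSubalgebra.inclusion (h𝒜 (Nat.le_succ k))))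
      (Γ (k + 1)) = Γ k

end MatrixSequence

end AFUltra

end

/-! For finite dimensional algebras the classification is elementary. A representation is a direct
sum of irreducible ones, so a unital morphism `F → G` is determined up to a unitary of `G` by its
multiplicities (`exists_unitary_of_mappingMatrix_eq`). Every nonnegative integer matrix carrying
`dimVec F` to `dimVec G` occurs (`exists_mappingMatrix_eq`), and composition of morphisms becomes
the matrix product (`mappingMatrix_comp`).

Two stability facts carry this over to the ultraproduct. Matrix units are weakly stable: approximate
matrix units in the `B i` can be corrected to exact ones, so `φ` restricted to `𝒜 k` comes from
genuine morphisms into `B i` for almost all `i` (`exists_local_lift`). Multiplicities are rigid: an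
invertible intertwiner in the ultraproduct, averaged over matrix units, becomes an exact invertible
intertwiner in almost all `B i` (`eventually_mappingMatrix_eq`). The second fact gives both
independence of the lifting and invariance under inner conjugacy.

Countable incompleteness passes from each `k` to all `k` at once. If for each `k` a condition holds
for almost all `i`, there is `κ : I → ℕ` tending to infinity along `U` such that condition `κ i`
holds at almost all `i` (`exists_diagonal`). This is used three times: to glue the local lifts into
one lifting, to choose unitaries `u i` conjugating two liftings on `𝒜 (κ i)` (injectivity), and to
realise the matrix of level `κ i` by a morphism `𝒜 (κ i) → B i` (surjectivity). In the last case the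
morphisms induce a map on the dense union, and contractivity extends it to `A`. -/

noncomputable section

namespace AFUltra

/-! ### Minimal projections and blocks of a finite dimensional C*-algebra. -/

/-- Serves two forms defined only implicitly: `star x * y = β x y • p` on a left ideal, and `Tᴴ * S
= β T S • 1` on intertwiners. -/
theorem exists_orthonormal_basis {V : Type*} [AddCommGroup V] [Module ℂ V]
    [FiniteDimensional ℂ V] (β : V → V → ℂ) (hsymm : ∀ x y, starRingEnd ℂ (β y x) = β x y)
    (hnonneg : ∀ x, 0 ≤ (β x x).re) (hadd : ∀ x y z, β (x + y) z = β x z + β y z)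
    (hsmul : ∀ x y (r : ℂ), β (r • x) y = starRingEnd ℂ r * β x y)
    (hdef : ∀ x, β x x = 0 → x = 0) :
    ∃ b : Module.Basis (Fin (Module.finrank ℂ V)) ℂ V,
      ∀ i j, β (b i) (b j) = if i = j then 1 else 0 := by
  let c : InnerProductSpace.Core ℂ V :=
    { inner := β
      conj_inner_symm := hsymm
      re_inner_nonneg := hnonneg
      add_left := hadd
      smul_left := hsmul
      definite := hdef }
  let := c.toNormedAddCommGroup
  let : InnerProductSpace ℂ V := InnerProductSpace.ofCore c.toCore
  refine ⟨(stdOrthonormalBasis ℂ V).toBasis, fun i j => ?_⟩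
  have h := orthonormal_iff_ite.mp (stdOrthonormalBasis ℂ V).orthonormal i j
  simpa using! h

/-- Minimise the dimension of the right ideal `pF`. If `p * q = q` then `qF ⊆ pF`, equality of
dimensions gives `q * p = p`, and the adjoint of `p * q = q` gives `q * p = q`. -/
theorem exists_minimal_projection {F : Type*} [Ring F] [StarRing F] [Algebra ℂ F]
    [FiniteDimensional ℂ F] (P : F → Prop) (hP : ∀ p, P p → IsStarProjection p)
    (h : ∃ p, P p) : ∃ p, P p ∧ ∀ q, P q → p * q = q → q = p := by
  let d : F → ℕ := fun p => Module.finrank ℂ (LinearMap.range (LinearMap.mulLeft ℂ p))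
  obtain ⟨p, hp, hmin⟩ := (measure d).wf.has_min {p | P p} h
  refine ⟨p, hp, fun q hq hpq => ?_⟩
  have hle : LinearMap.range (LinearMap.mulLeft ℂ q) ≤ LinearMap.range (LinearMap.mulLeft ℂ p) := by
    rintro _ ⟨x, rfl⟩
    exact ⟨q * x, by simp [← mul_assoc, hpq]⟩
  have heq := Submodule.eq_of_le_of_finrank_le hle (not_lt.mp (hmin q hq))
  have hmem : p ∈ LinearMap.range (LinearMap.mulLeft ℂ q) := by
    rw [heq]; exact ⟨1, by simp⟩
  obtain ⟨x, hx⟩ := hmem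
  have hx' : q * x = p := hx
  have h1 : q * p = p := by
    rw [← hx', ← mul_assoc, (hP q hq).isIdempotentElem.eq]
  have h2 : q * p = q := by
    have := congrArg star hpq
    rwa [star_mul, (hP q hq).isSelfAdjoint.star_eq, (hP p hp).isSelfAdjoint.star_eq] at this
  exact h2.symm.trans h1

section CStar

variable {F : Type*} [CStarAlgebra F] [FiniteDimensional ℂ F]

/-- The spectrum lies among the roots of the real minimal polynomial. Hence every function is
continuous on it, and indicator functions may be used in the functional calculus. -/
theorem finite_spectrum_real (a : F) : (spectrum ℝ a).Finite := by
  have : FiniteDimensional ℝ F := FiniteDimensional.complexToReal F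
  rcases subsingleton_or_nontrivial F with h | h
  · rw [spectrum.of_subsingleton]
    exact Set.finite_empty
  have hi : IsIntegral ℝ a := Algebra.IsIntegral.isIntegral a
  refine ((minpoly ℝ a).roots.toFinset.finite_toSet).subset fun t ht => ?_
  have h1 := spectrum.subset_polynomial_aeval a (minpoly ℝ a) ⟨t, ht, rfl⟩
  rw [minpoly.aeval, spectrum.zero_eq, Set.mem_singleton_iff] at h1
  simpa [minpoly.ne_zero hi] using h1

theorem continuousOn_spectrum (f : ℝ → ℝ) (a : F) : ContinuousOn f (spectrum ℝ a) :=
  (finite_spectrum_real a).continuousOn f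

theorem isStarProjection_cfc_indicator (s : Set ℝ) (a : F) :
    IsStarProjection (cfc (s.indicator 1) a) := by
  refine ⟨?_, cfc_predicate _ _⟩
  rw [IsIdempotentElem, ← cfc_mul _ _ a (continuousOn_spectrum _ _) (continuousOn_spectrum _ _)]
  congr 1
  funext t
  by_cases h : t ∈ s <;> simp [h]

/-- The spectral projection `q` at a nonzero eigenvalue `t` satisfies `q = t⁻¹ • (a * q)`, hence
lies below `p` and equals `p` by minimality; then `a = a * q = t • q`. If the spectrum has no
nonzero point, `a = 0`. -/
theorem eq_smul_of_isSelfAdjoint {p a : F}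
    (hmin : ∀ q, IsStarProjection q ∧ q ≠ 0 → p * q = q → q = p) (ha : IsSelfAdjoint a)
    (hpa : p * a = a) : ∃ c : ℝ, a = c • p := by
  by_cases h : ∃ t ∈ spectrum ℝ a, t ≠ 0
  · obtain ⟨t, ht, ht0⟩ := h
    set q := cfc (({t} : Set ℝ).indicator 1) a with hq
    have hc := fun f : ℝ → ℝ => continuousOn_spectrum f a
    have haq : a * q = t • q := by
      conv_lhs => rw [hq, ← cfc_id' ℝ a]
      rw [cfc_id' ℝ a, ← cfc_smul _ _ _ (hc _)]
      nth_rw 1 [← cfc_id' ℝ a]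
      rw [← cfc_mul _ _ a (hc _) (hc _)]
      congr 1
      funext s
      by_cases hs : s = t <;> simp [hs]
    have hq' : q = t⁻¹ • (a * q) := by rw [haq, smul_smul, inv_mul_cancel₀ ht0, one_smul]
    have hpq : p * q = q := by
      rw [hq', mul_smul_comm, ← mul_assoc, hpa]
    have hq0 : q ≠ 0 := by
      intro h0
      have := norm_apply_le_norm_cfc (({t} : Set ℝ).indicator 1) a ht (hc _) ha
      rw [← hq, h0] at this
      simp at this
      linarith
    have hqp := hmin q ⟨isStarProjection_cfc_indicator _ _, hq0⟩ hpq
    refine ⟨t, ?_⟩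
    rw [← hqp, ← haq, hqp]
    have := congrArg star hpa
    rw [star_mul, ha.star_eq, ← hqp, (isStarProjection_cfc_indicator _ _).isSelfAdjoint.star_eq,
      ← hq, hqp] at this
    exact this.symm
  · push Not at h
    refine ⟨0, ?_⟩
    rw [zero_smul, ← cfc_id' ℝ a, cfc_congr (g := fun _ => 0) (fun t ht => h t ht), cfc_const_zero]

theorem eq_smul_of_minimal {p a : F} (hp : IsStarProjection p)
    (hmin : ∀ q, IsStarProjection q ∧ q ≠ 0 → p * q = q → q = p)
    (hpa : p * a = a) (hap : a * p = a) : ∃ c : ℂ, a = c • p := by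
  have hpa' : p * star a = star a := by
    have := congrArg star hap
    rwa [star_mul, hp.isSelfAdjoint.star_eq] at this
  have h1 : p * (realPart a : F) = realPart a := by
    rw [realPart_apply_coe, mul_smul_comm, mul_add, hpa, hpa']
  have h2 : p * (imaginaryPart a : F) = imaginaryPart a := by
    rw [imaginaryPart_apply_coe, mul_smul_comm, mul_smul_comm, mul_sub, hpa, hpa']
  obtain ⟨c, hc⟩ := eq_smul_of_isSelfAdjoint hmin (realPart a).2 h1
  obtain ⟨d, hd⟩ := eq_smul_of_isSelfAdjoint hmin (imaginaryPart a).2 h2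
  refine ⟨c + Complex.I * d, ?_⟩
  rw [← realPart_add_I_smul_imaginaryPart a, hc, hd, add_smul, mul_smul]
  rfl

end CStar

section CStar

variable {F : Type*} [CStarAlgebra F] [FiniteDimensional ℂ F]

/-- For a minimal projection `p` below `e`, the corner `pFp` is `ℂp`, so `star x * y` is a scalar
multiple of `p` on the left ideal `Fp` and makes it a Hilbert space. The representation is left
multiplication on `Fp`, written in an orthonormal basis `v`. -/
theorem exists_isBlockRep (e : MinProj F) :
    ∃ (n : ℕ) (ρ : F →⋆ₐ[ℂ] Matrix (Fin n) (Fin n) ℂ), IsBlockRep e ρ := by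
  obtain ⟨p, ⟨⟨hp, hp0⟩, hep⟩, hmin'⟩ := exists_minimal_projection (F := F)
    (fun p => (IsStarProjection p ∧ p ≠ 0) ∧ e.1 * p = p) (fun p h => h.1.1)
    ⟨e.1, ⟨e.2.isStarProjection, e.2.ne_zero⟩, e.2.isStarProjection.isIdempotentElem.eq⟩
  have hmin : ∀ q, IsStarProjection q ∧ q ≠ 0 → p * q = q → q = p := fun q hq hpq =>
    hmin' q ⟨hq, by rw [← hpq, ← mul_assoc, hep]⟩ hpq
  have hpp : p * p = p := hp.isIdempotentElem.eq
  have hps : star p = p := hp.isSelfAdjoint.star_eq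
  have hinj : ∀ c d : ℂ, c • p = d • p → c = d := fun c d h => smul_left_injective ℂ hp0 h
  have hcorner : ∀ x y : F, x * p = x → y * p = y → ∃ c : ℂ, star x * y = c • p := by
    intro x y hx hy
    refine eq_smul_of_minimal hp hmin ?_ (by rw [mul_assoc, hy])
    rw [← mul_assoc, ← hps, ← star_mul, hx]
  let V : Submodule ℂ F := LinearMap.eqLocus (LinearMap.mulRight ℂ p) LinearMap.id
  have hV : ∀ x : V, (x : F) * p = x := fun x => x.2
  choose β hβ using fun x y : V => hcorner x y (hV x) (hV y)
  obtain ⟨b, hb⟩ := exists_orthonormal_basis β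
    (fun x y => hinj _ _ (by
      rw [← hβ, ← star_star (star (x : F) * y), star_mul, star_star, hβ, star_smul, hps]; rfl))
    (fun x => by
      let := CStarAlgebra.spectralOrder F
      have := CStarAlgebra.spectralOrderedRing F
      -- If the scalar were negative, `star x * x` would be both a nonnegative element and a
      -- negative multiple of the nonzero projection `p`.
      by_contra! hlt
      have hreal : starRingEnd ℂ (β x x) = β x x := hinj _ _ (by
        rw [← hβ, ← star_star (star (x : F) * x), star_mul, star_star, hβ, star_smul, hps]; rfl)
      have h1 : (β x x) • p = ((β x x).re) • p := by
        conv_lhs => rw [← Complex.conj_eq_iff_re.mp hreal]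
        exact Complex.coe_smul _ _
      have h2 : 0 ≤ ((β x x).re) • p := h1 ▸ hβ x x ▸ star_mul_self_nonneg _
      have h3 : 0 ≤ p := hp.nonneg
      have h4 : ((β x x).re) • p ≤ 0 := smul_nonpos_of_nonpos_of_nonneg hlt.le h3
      have h5 := le_antisymm h4 h2
      exact (smul_ne_zero hlt.ne hp0) h5)
    (fun x y z => hinj _ _ (by
      rw [add_smul, ← hβ, ← hβ, ← hβ, Submodule.coe_add, star_add, add_mul]))
    (fun x y r => hinj _ _ (by
      rw [mul_smul, ← hβ, ← hβ, Submodule.coe_smul, star_smul, smul_mul_assoc]; rfl))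
    (fun x h => by
      have := hβ x x
      rw [h, zero_smul, CStarRing.star_mul_self_eq_zero_iff] at this
      exact Subtype.ext this)
  generalize Module.finrank ℂ V = n at b hb
  let v : Fin n → F := fun i => b i
  have hvp : ∀ i, v i * p = v i := fun i => hV (b i)
  have hvv : ∀ i j, star (v i) * v j = if i = j then p else 0 := by
    intro i j
    rw [hβ, hb]; split_ifs <;> simp
  -- `q` acts as the identity on `Fp`. It will turn out to be a nonzero central projection below
  -- `e`, hence `e` itself.
  let q : F := ∑ i, v i * star (v i)
  have hqv : ∀ j, q * v j = v j := by
    intro j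
    simp only [q, Finset.sum_mul, mul_assoc, hvv]
    simp [hvp]
  have hqV : ∀ x : F, x * p = x → q * x = x := by
    intro x hx
    have h := b.sum_repr ⟨x, hx⟩
    have h' : x = ∑ i, b.repr ⟨x, hx⟩ i • v i := by
      have h'' := congrArg V.subtype h
      simp only [map_sum, map_smul] at h''
      exact h''.symm
    rw [h', Finset.mul_sum]
    simp [hqv]
  have hqs : star q = q := by simp [q]
  have hqq : q * q = q := by
    simp only [q, Finset.mul_sum, ← mul_assoc]
    exact Finset.sum_congr rfl fun j _ => by rw [hqv]
  have hxq : ∀ x : F, q * (x * q) = x * q := by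
    intro x
    simp only [q, Finset.mul_sum, ← mul_assoc]
    refine Finset.sum_congr rfl fun j _ => ?_
    rw [mul_assoc _ x, hqV _ (by rw [mul_assoc, hvp])]
  -- Comparing `q x q = x q` with its adjoint for `star x` gives centrality.
  have hqc : ∀ x : F, q * x = x * q := by
    intro x
    have h := congrArg star (hxq (star x))
    simp only [star_mul, star_star, hqs] at h
    rw [← h, mul_assoc, hxq]
  have hev : ∀ i, e.1 * v i = v i := by
    intro i
    rw [← hvp i, ← mul_assoc, ((Set.mem_center_iff.mp e.2.mem_center).comm (v i)).eq, mul_assoc,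
      hep]
  have hqe : q = e.1 := by
    rcases e.2.minimal q ⟨hqq, hqs⟩ (Semigroup.mem_center_iff.mpr fun g => (hqc g).symm) (by
      rw [hqc e.1]
      simp only [q, Finset.mul_sum, ← mul_assoc, hev]) with h | h
    · exact absurd (by rw [← hqV p hpp, h, zero_mul]) hp0
    · exact h
  choose r hr using fun (x : F) (i j : Fin n) =>
    hcorner (v i) (x * v j) (hvp i) (by rw [mul_assoc, hvp])
  have hrmul : ∀ x y i j, r (x * y) i j = ∑ k, r x i k * r y k j := by
    intro x y i j
    apply hinj
    have : star (v i) * (x * y * v j) = star (v i) * x * q * (y * v j) := by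
      rw [mul_assoc (star (v i) * x), hqV _ (by rw [mul_assoc, hvp])]
      simp only [mul_assoc]
    rw [← hr, this, Finset.sum_smul]
    simp only [q, Finset.mul_sum, Finset.sum_mul]
    refine Finset.sum_congr rfl fun k _ => ?_
    have : star (v i) * x * (v k * star (v k)) * (y * v j)
      = (star (v i) * (x * v k)) * (star (v k) * (y * v j)) := by simp only [mul_assoc]
    rw [this, hr, hr, smul_mul_smul_comm, hpp]
  let ρ : F →⋆ₐ[ℂ] Matrix (Fin n) (Fin n) ℂ :=
    { toFun := fun x => Matrix.of (r x)
      map_one' := by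
        ext i j
        refine hinj _ _ ?_
        rw [Matrix.of_apply, ← hr, one_mul, hvv, Matrix.one_apply]
        split_ifs <;> simp
      map_mul' := fun x y => by
        ext i j
        simp [Matrix.mul_apply, hrmul]
      map_zero' := by
        ext i j
        refine hinj _ _ ?_
        simp [← hr]
      map_add' := fun x y => by
        ext i j
        refine hinj _ _ ?_
        simp [← hr, add_smul, add_mul, mul_add]
      commutes' := fun c => by
        ext i j
        refine hinj _ _ ?_
        rw [Matrix.of_apply, ← hr, Algebra.algebraMap_eq_smul_one, smul_one_mul, mul_smul_comm,
          hvv, Matrix.algebraMap_matrix_apply]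
        split_ifs <;> simp
      map_star' := fun x => by
        ext i j
        refine hinj _ _ ?_
        rw [Matrix.of_apply, ← hr, Matrix.star_apply, Matrix.of_apply,
          ← star_star (star (v i) * (star x * v j))]
        have : star (star (v i) * (star x * v j)) = star (v j) * (x * v i) := by
          simp [mul_assoc]
        rw [this, hr, star_smul, hps] }
  have hρ : ∀ x i j, ρ x i j • p = star (v i) * (x * v j) := fun x i j => (hr x i j).symm
  -- The elements `v i * star (v j)` go to the standard matrix units, which yields surjectivity.
  have hEv : ∀ i j k l, ρ (v i * star (v j)) k l = if i = k ∧ j = l then 1 else 0 := by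
    intro i j k l
    refine hinj _ _ ?_
    rw [hρ, mul_assoc (v i), hvv, ← mul_assoc, hvv]
    by_cases h1 : k = i <;> by_cases h2 : j = l <;> simp [h1, h2, hpp, eq_comm]
    · intro h; exact absurd h.symm h1
  refine ⟨n, ρ, fun M => ⟨∑ i, ∑ j, M i j • (v i * star (v j)), ?_⟩, fun x => ⟨fun h => ?_, fun h => ?_⟩⟩
  · ext k l
    simp only [map_sum, map_smul, Matrix.sum_apply, Matrix.smul_apply, hEv]
    simp [ite_and]
  · have h1 : ∀ i j, star (v i) * (x * v j) = 0 := fun i j => by rw [← hρ, h]; simp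
    rw [← hqe, ← hxq]
    simp only [q, Finset.mul_sum, Finset.sum_mul]
    refine Finset.sum_eq_zero fun i _ => Finset.sum_eq_zero fun j _ => ?_
    have : v j * star (v j) * (x * (v i * star (v i)))
      = v j * (star (v j) * (x * v i)) * star (v i) := by simp only [mul_assoc]
    rw [this, h1, mul_zero, zero_mul]
  · ext i j
    refine hinj _ _ ?_
    rw [hρ, ← hev j, ← mul_assoc x, h]; simp

/-- Otherwise `1 - s` is a nonzero central projection. A smallest nonzero central projection
orthogonal to `s` is then minimal among all central ones, hence a summand of `s`: a contradiction.
-/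
theorem sum_minProj_eq_one : ∑ e : MinProj F, e.1 = 1 := by
  by_contra hne
  let s : F := ∑ e : MinProj F, e.1
  have hse : ∀ e : MinProj F, s * e.1 = e.1 := by
    intro e
    simp only [s, Finset.sum_mul]
    rw [Finset.sum_eq_single e (fun f _ hf => MinProj.mul_eq_zero hf) (by simp)]
    exact e.2.isStarProjection.isIdempotentElem.eq
  have hsc : s ∈ Set.center F :=
    (Subring.center F).sum_mem fun e _ => e.2.mem_center
  have hs : IsStarProjection s := by
    refine ⟨?_, ?_⟩
    · change s * ∑ e : MinProj F, e.1 = s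
      rw [Finset.mul_sum]
      exact Finset.sum_congr rfl fun e _ => hse e
    · exact isSelfAdjoint_sum _ fun e _ => e.2.isStarProjection.isSelfAdjoint
  obtain ⟨p, ⟨hp, hpc, hp0, hps⟩, hmin⟩ := exists_minimal_projection (F := F)
    (fun p => IsStarProjection p ∧ p ∈ Set.center F ∧ p ≠ 0 ∧ s * p = 0) (fun p h => h.1)
    ⟨1 - s, hs.one_sub, (Subring.center F).sub_mem (Subring.center F).one_mem hsc,
      fun h => hne (sub_eq_zero.mp h).symm, hs.mul_one_sub_self⟩
  have hpm : IsMinCentralProj p := by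
    refine ⟨hp, hpc, hp0, fun q hq hqc hqp => ?_⟩
    by_cases hq0 : q = 0
    · exact Or.inl hq0
    have hcomm : p * q = q * p := (Semigroup.mem_center_iff.mp hqc p)
    refine Or.inr (hmin q ⟨hq, hqc, hq0, ?_⟩ (hcomm.trans hqp))
    rw [← hqp, ← hcomm, ← mul_assoc, hps, zero_mul]
  exact hp0 ((hse ⟨p, hpm⟩).symm.trans hps)

end CStar

/-- The structure of finite dimensional C*-algebras: every minimal central projection is the unit
of a full matrix algebra and the minimal central projections sum up to the unit. -/
structure HasBlocks (F : Type*) [Ring F] [StarRing F] [Algebra ℂ F] [FiniteDimensional ℂ F] :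
    Prop where
  isBlockRep : ∀ e : MinProj F, IsBlockRep e (blockRep e).2
  sum_eq_one : ∑ e : MinProj F, e.1 = 1

theorem hasBlocks (F : Type*) [CStarAlgebra F] [FiniteDimensional ℂ F] : HasBlocks F where
  isBlockRep e := by
    obtain ⟨n, ρ, h⟩ := exists_isBlockRep e
    exact @Classical.epsilon_spec _
      (fun p : Σ n : ℕ, F →⋆ₐ[ℂ] Matrix (Fin n) (Fin n) ℂ => IsBlockRep e p.2) ⟨⟨n, ρ⟩, h⟩
  sum_eq_one := sum_minProj_eq_one

theorem hasBlocks_starSubalgebra {A : Type*} [CStarAlgebra A] (S : StarSubalgebra ℂ A)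
    [FiniteDimensional ℂ S] : HasBlocks S := by
  have : IsClosed (S : Set A) := (Subalgebra.toSubmodule S.toSubalgebra).closed_of_finiteDimensional
  exact hasBlocks S

namespace HasBlocks

variable {F : Type*} [Ring F] [StarRing F] [Algebra ℂ F] [FiniteDimensional ℂ F]

theorem blockRep_self (hF : HasBlocks F) (e : MinProj F) : (blockRep e).2 e.1 = 1 := by
  have := ((hF.isBlockRep e).2 (1 - e.1)).mpr e.2.isStarProjection.one_sub_mul_self
  rw [map_sub, map_one, sub_eq_zero] at this
  exact this.symm

theorem blockRep_of_ne (hF : HasBlocks F) {e f : MinProj F} (h : e ≠ f) :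
    (blockRep e).2 f.1 = 0 :=
  ((hF.isBlockRep e).2 _).mpr (MinProj.mul_eq_zero h.symm)

/-- The map of `F` to the product of its blocks. -/
def toBlocks (F : Type*) [Ring F] [StarRing F] [Algebra ℂ F] :
    F →⋆ₐ[ℂ] (∀ e : MinProj F, Matrix (Fin (blockRep e).1) (Fin (blockRep e).1) ℂ) where
  toFun x e := (blockRep e).2 x
  map_one' := funext fun _ => map_one _
  map_mul' x y := funext fun _ => map_mul _ x y
  map_zero' := funext fun _ => map_zero _
  map_add' x y := funext fun _ => map_add _ x y
  commutes' c := funext fun _ => AlgHomClass.commutes _ c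
  map_star' x := funext fun _ => map_star _ x

theorem toBlocks_bijective (hF : HasBlocks F) : Function.Bijective (toBlocks F) := by
  classical
  constructor
  · rw [injective_iff_map_eq_zero]
    intro x hx
    rw [← mul_one x, ← hF.sum_eq_one, Finset.mul_sum]
    exact Finset.sum_eq_zero fun e _ => ((hF.isBlockRep e).2 x).mp (congrFun hx e)
  · intro M
    choose x hx using fun e => (hF.isBlockRep e).1 (M e)
    refine ⟨∑ e, x e * e.1, funext fun f => ?_⟩
    change (blockRep f).2 _ = _
    rw [map_sum, Finset.sum_eq_single f]
    · rw [map_mul, hF.blockRep_self, mul_one, hx]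
    · intro e _ he
      rw [map_mul, hF.blockRep_of_ne he.symm, mul_zero]
    · simp

/-- A finite dimensional C*-algebra is the product of its blocks. -/
def equivBlocks (hF : HasBlocks F) :
    F ≃⋆ₐ[ℂ] (∀ e : MinProj F, Matrix (Fin (blockRep e).1) (Fin (blockRep e).1) ℂ) :=
  StarAlgEquiv.ofBijective (toBlocks F) hF.toBlocks_bijective

theorem equivBlocks_apply (hF : HasBlocks F) (x : F) (e : MinProj F) :
    hF.equivBlocks x e = (blockRep e).2 x := rfl

theorem blockRep_equivBlocks_symm (hF : HasBlocks F)
    (M : ∀ e : MinProj F, Matrix (Fin (blockRep e).1) (Fin (blockRep e).1) ℂ) (e : MinProj F) :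
    (blockRep e).2 (hF.equivBlocks.symm M) = M e := by
  rw [← hF.equivBlocks_apply, StarAlgEquiv.apply_symm_apply]

theorem dimVec_pos (hF : HasBlocks F) (e : MinProj F) : 0 < dimVec F e := by
  rw [Nat.pos_iff_ne_zero]
  intro h
  have : Subsingleton (Matrix (Fin (blockRep e).1) (Fin (blockRep e).1) ℂ) := by
    change Subsingleton (Matrix (Fin (dimVec F e)) (Fin (dimVec F e)) ℂ)
    rw [h]; infer_instance
  have h0 := ((hF.isBlockRep e).2 1).mp (@Subsingleton.elim _ this _ _)
  rw [one_mul] at h0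
  exact e.2.ne_zero h0

end HasBlocks

/-! ### Matrix units. -/

namespace HasBlocks

variable {F : Type*} [Ring F] [StarRing F] [Algebra ℂ F] [FiniteDimensional ℂ F]

theorem ext_blockRep (hF : HasBlocks F) {x y : F}
    (h : ∀ e : MinProj F, (blockRep e).2 x = (blockRep e).2 y) : x = y :=
  hF.toBlocks_bijective.1 (funext h)

open Classical in
/-- The matrix units of a finite dimensional C*-algebra. -/
def matUnit (hF : HasBlocks F) (e : MinProj F) (a b : Fin (blockRep e).1) : F :=
  hF.equivBlocks.symm (Pi.single e (Matrix.single a b 1))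

variable (hF : HasBlocks F)

theorem blockRep_matUnit (e : MinProj F) (a b : Fin (blockRep e).1) :
    (blockRep e).2 (hF.matUnit e a b) = Matrix.single a b 1 := by
  classical
  exact (hF.blockRep_equivBlocks_symm _ e).trans (Pi.single_eq_same _ _)

theorem blockRep_matUnit_of_ne {e f : MinProj F} (h : f ≠ e) (a b : Fin (blockRep e).1) :
    (blockRep f).2 (hF.matUnit e a b) = 0 := by
  classical
  exact (hF.blockRep_equivBlocks_symm _ f).trans (Pi.single_eq_of_ne h _)

/-- Each column of matrix units spans a copy of the irreducible representation; the intertwining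
computations below rest on this and on its row version. -/
theorem mul_matUnit (x : F) (e : MinProj F) (a b : Fin (blockRep e).1) :
    x * hF.matUnit e a b = ∑ c, (blockRep e).2 x c a • hF.matUnit e c b := by
  refine hF.ext_blockRep fun f => ?_
  simp only [map_mul, map_sum, map_smul]
  by_cases h : f = e
  · subst h
    simp only [blockRep_matUnit]
    ext i j
    simp [Matrix.mul_apply, Matrix.sum_apply, Matrix.single_apply, ite_and]
  · simp [hF.blockRep_matUnit_of_ne h]

theorem matUnit_mul (x : F) (e : MinProj F) (a b : Fin (blockRep e).1) :
    hF.matUnit e a b * x = ∑ c, (blockRep e).2 x b c • hF.matUnit e a c := by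
  refine hF.ext_blockRep fun f => ?_
  simp only [map_mul, map_sum, map_smul]
  by_cases h : f = e
  · subst h
    simp only [blockRep_matUnit]
    ext i j
    simp [Matrix.mul_apply, Matrix.sum_apply, Matrix.single_apply, ite_and]
  · simp [hF.blockRep_matUnit_of_ne h]

theorem matUnit_mul_matUnit (e : MinProj F) (a b c : Fin (blockRep e).1) :
    hF.matUnit e a b * hF.matUnit e b c = hF.matUnit e a c := by
  rw [mul_matUnit, blockRep_matUnit]
  simp [Matrix.single_apply]

theorem matUnit_mul_matUnit_of_ne (e : MinProj F) {b b' : Fin (blockRep e).1} (h : b ≠ b')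
    (a c : Fin (blockRep e).1) :
    hF.matUnit e a b * hF.matUnit e b' c = 0 := by
  rw [mul_matUnit, blockRep_matUnit]
  simp [h]

theorem matUnit_mul_matUnit_of_ne' {e f : MinProj F} (h : e ≠ f) (a b : Fin (blockRep e).1)
    (c d : Fin (blockRep f).1) : hF.matUnit e a b * hF.matUnit f c d = 0 := by
  rw [mul_matUnit, hF.blockRep_matUnit_of_ne h.symm]
  simp

theorem star_matUnit (e : MinProj F) (a b : Fin (blockRep e).1) :
    star (hF.matUnit e a b) = hF.matUnit e b a := by
  refine hF.ext_blockRep fun f => ?_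
  rw [map_star]
  by_cases h : f = e
  · subst h
    simp only [blockRep_matUnit]
    ext i j
    simp [Matrix.single_apply, and_comm, apply_ite]
  · simp [hF.blockRep_matUnit_of_ne h]

theorem sum_matUnit : ∑ e, ∑ a, hF.matUnit e a a = 1 := by
  refine hF.ext_blockRep fun f => ?_
  simp only [map_sum, map_one]
  rw [Finset.sum_eq_single f]
  · simp only [blockRep_matUnit, Matrix.sum_single_one]
  · intro e _ h
    simp [hF.blockRep_matUnit_of_ne h.symm]
  · simp

theorem eq_sum_matUnit (x : F) :
    x = ∑ e, ∑ a, ∑ b, (blockRep e).2 x a b • hF.matUnit e a b := by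
  conv_lhs => rw [← mul_one x, ← hF.sum_matUnit]
  simp only [Finset.mul_sum, mul_matUnit]
  exact Finset.sum_congr rfl fun e _ => Finset.sum_comm

end HasBlocks

/-! ### Decomposition of representations into irreducible ones. -/

section Decomp

variable {F : Type*} [Ring F] [StarRing F] [Algebra ℂ F] [FiniteDimensional ℂ F]

/-- A decomposition of the representation `σ` into irreducible representations, given by isometric
intertwiners `T e r` which have pairwise orthogonal ranges with sum the whole space. -/
structure IsDecomp {m : ℕ} (σ : F →⋆ₐ[ℂ] Matrix (Fin m) (Fin m) ℂ) (J : MinProj F → Type*)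
    [∀ e, Fintype (J e)] (T : ∀ e, J e → Matrix (Fin m) (Fin (blockRep e).1) ℂ) : Prop where
  mem : ∀ e r, T e r ∈ intertwiners (blockRep e).2 σ
  orth_self : ∀ e r, (T e r)ᴴ * T e r = 1
  orth_ne : ∀ e r s, r ≠ s → (T e r)ᴴ * T e s = 0
  complete : ∑ e, ∑ r, T e r * (T e r)ᴴ = 1

omit [FiniteDimensional ℂ F] in
theorem conjTranspose_mul_of_mem {m n : ℕ} {σ : F →⋆ₐ[ℂ] Matrix (Fin m) (Fin m) ℂ}
    {ρ : F →⋆ₐ[ℂ] Matrix (Fin n) (Fin n) ℂ} {T : Matrix (Fin m) (Fin n) ℂ}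
    (hT : T ∈ intertwiners ρ σ) (x : F) : Tᴴ * σ x = ρ x * Tᴴ := by
  have h := congrArg Matrix.conjTranspose (hT (star x))
  rw [Matrix.conjTranspose_mul, Matrix.conjTranspose_mul] at h
  simpa [map_star, Matrix.star_eq_conjTranspose] using h

/-- Schur orthogonality: the central projection `e` acts as `1` in its own block and as `0` in the
block of `f`. -/
theorem conjTranspose_mul_eq_zero (hF : HasBlocks F) {m : ℕ}
    {σ : F →⋆ₐ[ℂ] Matrix (Fin m) (Fin m) ℂ} {e f : MinProj F} (hef : e ≠ f) {T S}
    (hT : T ∈ intertwiners (blockRep e).2 σ) (hS : S ∈ intertwiners (blockRep f).2 σ) :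
    Tᴴ * S = 0 := by
  calc Tᴴ * S = (blockRep e).2 e.1 * Tᴴ * S := by rw [hF.blockRep_self, Matrix.one_mul]
    _ = Tᴴ * (S * (blockRep f).2 e.1) := by
      rw [← conjTranspose_mul_of_mem hT, Matrix.mul_assoc, hS]
    _ = 0 := by rw [hF.blockRep_of_ne hef.symm, Matrix.mul_zero, Matrix.mul_zero]

/-- Schur's lemma: `Tᴴ * S` commutes with the image of the irreducible representation, which is the
whole matrix algebra. -/
theorem exists_conjTranspose_mul_eq_smul (hF : HasBlocks F) {m : ℕ}
    {σ : F →⋆ₐ[ℂ] Matrix (Fin m) (Fin m) ℂ} {e : MinProj F} {T S}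
    (hT : T ∈ intertwiners (blockRep e).2 σ) (hS : S ∈ intertwiners (blockRep e).2 σ) :
    ∃ c : ℂ, Tᴴ * S = c • 1 := by
  have h : Tᴴ * S ∈ Set.range (Matrix.scalar (Fin (blockRep e).1)) := by
    refine Matrix.mem_range_scalar_iff_commute_single'.mpr fun i j => ?_
    obtain ⟨x, hx⟩ := (hF.isBlockRep e).1 (Matrix.single i j 1)
    rw [← hx, Commute, SemiconjBy, ← Matrix.mul_assoc, ← conjTranspose_mul_of_mem hT,
      Matrix.mul_assoc, hS, Matrix.mul_assoc]
  obtain ⟨c, hc⟩ := h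
  exact ⟨c, by rw [← hc, Matrix.scalar_apply, Matrix.smul_one_eq_diagonal]⟩

-- Orthonormal bases of the intertwiner spaces give isometries with orthogonal ranges. The
-- complementary projection `Q` kills every intertwiner and commutes with `σ`; a nonzero `Q` would
-- produce an intertwiner that it does not kill.
open scoped ComplexOrder in
theorem exists_isDecomp (hF : HasBlocks F) {m : ℕ} (σ : F →⋆ₐ[ℂ] Matrix (Fin m) (Fin m) ℂ) :
    ∃ T, IsDecomp σ (fun e => Fin (multiplicity (blockRep e).2 σ)) T := by
  simp only [multiplicity]
  have key : ∀ e : MinProj F, ∃ b : Module.Basis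
      (Fin (Module.finrank ℂ (intertwiners (blockRep e).2 σ))) ℂ (intertwiners (blockRep e).2 σ), ∀ i j, (b i).1ᴴ * (b j).1 = if i = j then 1 else 0 := by
    intro e
    have hpos := hF.dimVec_pos e
    let i0 : Fin (blockRep e).1 := ⟨0, hpos⟩
    have hone : (1 : Matrix (Fin (blockRep e).1) (Fin (blockRep e).1) ℂ) ≠ 0 := fun h => by
      simpa using congrFun (congrFun h i0) i0
    have hinj : ∀ c d : ℂ, c • (1 : Matrix (Fin (blockRep e).1) (Fin (blockRep e).1) ℂ) = d • 1
      → c = d := fun c d h => smul_left_injective ℂ hone h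
    choose β hβ using fun T S : intertwiners (blockRep e).2 σ =>
      exists_conjTranspose_mul_eq_smul hF T.2 S.2
    have hβ0 : ∀ T S, β T S = ∑ k, starRingEnd ℂ (T.1 k i0) * S.1 k i0 := by
      intro T S
      have := congrFun (congrFun (hβ T S) i0) i0
      simpa [Matrix.mul_apply] using this.symm
    obtain ⟨b, hb⟩ := exists_orthonormal_basis β
      (fun x y => by simp [hβ0, mul_comm])
      (fun x => by
        rw [hβ0, Complex.re_sum]
        refine Finset.sum_nonneg fun k _ => ?_
        rw [← Complex.normSq_eq_conj_mul_self, Complex.ofReal_re]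
        exact Complex.normSq_nonneg _)
      (fun x y z => by simp [hβ0, add_mul, Finset.sum_add_distrib])
      (fun x y r => by simp [hβ0, Finset.mul_sum, mul_assoc])
      (fun x h => by
        have := hβ x x
        rw [h, zero_smul, Matrix.conjTranspose_mul_self_eq_zero] at this
        exact Subtype.ext this)
    refine ⟨b, fun i j => ?_⟩
    rw [hβ, hb]
    split_ifs <;> simp
  choose b hb using key
  have hmem : ∀ e r, (b e r).1 ∈ intertwiners (blockRep e).2 σ := fun e r => (b e r).2
  refine ⟨fun e r => (b e r).1, hmem, fun e r => by simp [hb], fun e r s h => by simp [hb, h], ?_⟩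
  set Q : Matrix (Fin m) (Fin m) ℂ := 1 - ∑ e, ∑ r, (b e r).1 * (b e r).1ᴴ with hQ
  have hQT : ∀ e r, Q * (b e r).1 = 0 := by
    intro e r
    rw [hQ, Matrix.sub_mul, Matrix.one_mul, Matrix.sum_mul, Finset.sum_eq_single e,
      Matrix.sum_mul, Finset.sum_eq_single r, Matrix.mul_assoc, hb]
    · simp
    · intro s _ hs
      rw [Matrix.mul_assoc, hb, if_neg hs, Matrix.mul_zero]
    · simp
    · intro f _ hf
      rw [Matrix.sum_mul]
      refine Finset.sum_eq_zero fun s _ => ?_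
      rw [Matrix.mul_assoc, conjTranspose_mul_eq_zero hF hf (hmem _ _) (hmem _ _), Matrix.mul_zero]
    · simp
  have hQS : ∀ e, ∀ S ∈ intertwiners (blockRep e).2 σ, Q * S = 0 := by
    intro e S hS
    have h := congrArg (intertwiners (blockRep e).2 σ).subtype ((b e).sum_repr ⟨S, hS⟩)
    simp only [map_sum, map_smul, Submodule.subtype_apply] at h
    rw [← h, Matrix.mul_sum]
    exact Finset.sum_eq_zero fun r _ => by rw [Matrix.mul_smul, hQT, smul_zero]
  have hQσ : ∀ x, Q * σ x = σ x * Q := by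
    intro x
    rw [hQ, sub_mul, mul_sub, one_mul, mul_one]
    simp only [Finset.sum_mul, Finset.mul_sum]
    congr 1
    refine Finset.sum_congr rfl fun e _ => Finset.sum_congr rfl fun r _ => ?_
    rw [Matrix.mul_assoc, conjTranspose_mul_of_mem (hmem e r), ← Matrix.mul_assoc (σ x),
      hmem e r x, Matrix.mul_assoc]
  have hQQ : Q * Q = Q := by
    conv_lhs => enter [2]; rw [hQ]
    rw [mul_sub, mul_one, Finset.mul_sum]
    rw [Finset.sum_eq_zero, sub_zero]
    intro e _
    rw [Finset.mul_sum]
    exact Finset.sum_eq_zero fun r _ => by rw [← Matrix.mul_assoc, hQT, Matrix.zero_mul]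
  have hEQ : ∀ e a a', σ (hF.matUnit e a' a) * Q = 0 := by
    intro e a a'
    ext i j
    -- Fixing `a` and a column `j` of `Q`, the vectors `σ(E_{ca}) Q e_j` transform under `σ` like
    -- the standard basis of the block, so they are the columns of an intertwiner.
    let S : Matrix (Fin m) (Fin (blockRep e).1) ℂ :=
      Matrix.of fun i c => (σ (hF.matUnit e c a) * Q) i j
    have hS : S ∈ intertwiners (blockRep e).2 σ := by
      intro x
      ext i c
      have h1 : (σ x * S) i c = (σ (x * hF.matUnit e c a) * Q) i j := by
        rw [map_mul, mul_assoc]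
        simp only [S, Matrix.mul_apply (M := σ x), Matrix.of_apply]
      rw [h1, HasBlocks.mul_matUnit, map_sum, Finset.sum_mul, Matrix.sum_apply, Matrix.mul_apply]
      refine Finset.sum_congr rfl fun d _ => ?_
      rw [map_smul, Matrix.smul_mul, Matrix.smul_apply, smul_eq_mul, mul_comm]
      rfl
    have h0 : (Q * S) i a' = (Q * (σ (hF.matUnit e a' a) * Q)) i j := by
      simp only [S, Matrix.mul_apply (M := Q), Matrix.of_apply]
    rw [hQS e S hS, ← mul_assoc, hQσ, mul_assoc, hQQ] at h0
    exact h0.symm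
  have hQ0 : Q = 0 := by
    rw [← one_mul Q, ← map_one σ, ← hF.sum_matUnit]
    simp only [map_sum, Finset.sum_mul, hEQ, Finset.sum_const_zero]
  exact (sub_eq_zero.mp hQ0).symm

namespace IsDecomp

variable {m : ℕ} {σ : F →⋆ₐ[ℂ] Matrix (Fin m) (Fin m) ℂ} {J : MinProj F → Type*}
  [∀ e, Fintype (J e)] {T : ∀ e, J e → Matrix (Fin m) (Fin (blockRep e).1) ℂ}

/-- The `T e r` form a basis of the intertwiner space: orthogonality gives independence, and
completeness with Schur's lemma gives spanning. Multiplicities can thus be counted in any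
decomposition. -/
theorem multiplicity_eq (hF : HasBlocks F) (h : IsDecomp σ J T) (e : MinProj F) :
    multiplicity (blockRep e).2 σ = Fintype.card (J e) := by
  classical
  let v : J e → intertwiners (blockRep e).2 σ := fun r => ⟨T e r, h.mem e r⟩
  have hpos := hF.dimVec_pos e
  let i0 : Fin (blockRep e).1 := ⟨0, hpos⟩
  have hone : (1 : Matrix (Fin (blockRep e).1) (Fin (blockRep e).1) ℂ) ≠ 0 := fun h => by
    simpa using congrFun (congrFun h i0) i0
  have hv : LinearIndependent ℂ v := by
    rw [Fintype.linearIndependent_iff]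
    intro g hg s
    have h1 := congrArg (fun S => (T e s)ᴴ * S)
      (congrArg (intertwiners (blockRep e).2 σ).subtype hg)
    simp only [map_sum, map_smul, Submodule.subtype_apply, map_zero, Matrix.mul_zero,
      Matrix.mul_sum, v] at h1
    rw [Finset.sum_eq_single s (fun r _ hr => by
      rw [Matrix.mul_smul, h.orth_ne e s r hr.symm, smul_zero]) (by simp), Matrix.mul_smul,
      h.orth_self] at h1
    exact (smul_eq_zero.mp h1).resolve_right hone
  have hspan : ⊤ ≤ Submodule.span ℂ (Set.range v) := by
    rintro ⟨S, hS⟩ -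
    choose c hc using fun r => exists_conjTranspose_mul_eq_smul hF (h.mem e r) hS
    have h1 : S = ∑ r, c r • T e r := by
      conv_lhs => rw [← Matrix.one_mul S, ← h.complete, Matrix.sum_mul]
      rw [Finset.sum_eq_single e, Matrix.sum_mul]
      · refine Finset.sum_congr rfl fun r _ => ?_
        rw [Matrix.mul_assoc, hc, Matrix.mul_smul, Matrix.mul_one]
      · intro f _ hf
        rw [Matrix.sum_mul]
        refine Finset.sum_eq_zero fun r _ => ?_
        rw [Matrix.mul_assoc, conjTranspose_mul_eq_zero hF hf (h.mem f r) hS, Matrix.mul_zero]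
      · simp
    have h2 : (⟨S, hS⟩ : intertwiners (blockRep e).2 σ) = ∑ r, c r • v r := by
      apply Subtype.ext
      simpa [v] using h1
    rw [h2]
    exact Submodule.sum_mem _ fun r _ => Submodule.smul_mem _ _ (Submodule.subset_span ⟨r, rfl⟩)
  exact Module.finrank_eq_card_basis (Module.Basis.mk hv hspan)

/-- Take traces in the completeness relation. -/
theorem sum_card_mul (h : IsDecomp σ J T) :
    ∑ e, Fintype.card (J e) * dimVec F e = m := by
  have h1 := congrArg Matrix.trace h.complete
  simp only [Matrix.trace_sum, Matrix.trace_one, Fintype.card_fin] at h1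
  have h2 : ∀ e r, (T e r * (T e r)ᴴ).trace = (dimVec F e : ℂ) := fun e r => by
    rw [Matrix.trace_mul_comm, h.orth_self, Matrix.trace_one, Fintype.card_fin]; rfl
  simp only [h2, Finset.sum_const, Finset.card_univ, nsmul_eq_mul] at h1
  exact_mod_cast h1

/-- The unitary `∑ T' Tᴴ` matches the summands of the two decompositions one by one. -/
theorem exists_unitary (hF : HasBlocks F) {σ' : F →⋆ₐ[ℂ] Matrix (Fin m) (Fin m) ℂ}
    {T' : ∀ e, J e → Matrix (Fin m) (Fin (blockRep e).1) ℂ} (h : IsDecomp σ J T)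
    (h' : IsDecomp σ' J T') :
    ∃ u ∈ unitary (Matrix (Fin m) (Fin m) ℂ), ∀ x, σ x = star u * σ' x * u := by
  have aux : ∀ {σ σ' : F →⋆ₐ[ℂ] Matrix (Fin m) (Fin m) ℂ}
      {T T' : ∀ e, J e → Matrix (Fin m) (Fin (blockRep e).1) ℂ}, IsDecomp σ J T →
      IsDecomp σ' J T' →
      (∑ e, ∑ r, T e r * (T' e r)ᴴ) * (∑ e, ∑ r, T' e r * (T e r)ᴴ) = 1 := by
    intro σ σ' T T' h h'
    rw [← h.complete, Finset.sum_mul]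
    refine Finset.sum_congr rfl fun e _ => ?_
    rw [Finset.sum_mul]
    refine Finset.sum_congr rfl fun r _ => ?_
    rw [Finset.mul_sum, Finset.sum_eq_single e, Finset.mul_sum, Finset.sum_eq_single r]
    · rw [Matrix.mul_assoc, ← Matrix.mul_assoc _ (T' e r), h'.orth_self, Matrix.one_mul]
    · intro s _ hs
      rw [Matrix.mul_assoc, ← Matrix.mul_assoc _ (T' e s), h'.orth_ne e r s hs.symm,
        Matrix.zero_mul, Matrix.mul_zero]
    · simp
    · intro f _ hf
      rw [Finset.mul_sum]
      refine Finset.sum_eq_zero fun s _ => ?_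
      rw [Matrix.mul_assoc, ← Matrix.mul_assoc _ (T' f s),
        conjTranspose_mul_eq_zero hF hf.symm (h'.mem e r) (h'.mem f s),
        Matrix.zero_mul, Matrix.mul_zero]
    · simp
  have hstar : star (∑ e, ∑ r, T' e r * (T e r)ᴴ) = ∑ e, ∑ r, T e r * (T' e r)ᴴ := by
    simp [Matrix.star_eq_conjTranspose]
  refine ⟨∑ e, ∑ r, T' e r * (T e r)ᴴ, ?_, fun x => ?_⟩
  · rw [Unitary.mem_iff, hstar]
    exact ⟨aux h h', aux h' h⟩
  · have : σ' x * (∑ e, ∑ r, T' e r * (T e r)ᴴ) = (∑ e, ∑ r, T' e r * (T e r)ᴴ) * σ x := by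
      simp only [Finset.sum_mul, Finset.mul_sum]
      refine Finset.sum_congr rfl fun e _ => Finset.sum_congr rfl fun r _ => ?_
      rw [Matrix.mul_assoc, conjTranspose_mul_of_mem (h.mem e r), ← Matrix.mul_assoc (σ' x),
        h'.mem e r x, Matrix.mul_assoc]
    rw [mul_assoc, this, ← mul_assoc, hstar, aux h h', one_mul]

/-- The index set of the composite decomposition is chosen so that its cardinality is the entry of a
matrix product. -/
theorem comp {G : Type*} [Ring G] [StarRing G] [Algebra ℂ G] [FiniteDimensional ℂ G] {m : ℕ}
    {τ : G →⋆ₐ[ℂ] Matrix (Fin m) (Fin m) ℂ} {K : MinProj G → Type*} [∀ f, Fintype (K f)]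
    {S : ∀ f, K f → Matrix (Fin m) (Fin (blockRep f).1) ℂ} (hS : IsDecomp τ K S) (φ : F →⋆ₐ[ℂ] G)
    {J : MinProj G → MinProj F → Type*} [∀ f e, Fintype (J f e)]
    {T : ∀ f e, J f e → Matrix (Fin (blockRep f).1) (Fin (blockRep e).1) ℂ}
    (hT : ∀ f, IsDecomp ((blockRep f).2.comp φ) (J f) (T f)) (hG : HasBlocks G) :
    IsDecomp (τ.comp φ) (fun e => Σ f, K f × J f e)
      (fun e r => S r.1 r.2.1 * T r.1 e r.2.2) := by
  refine ⟨?_, ?_, ?_, ?_⟩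
  · rintro e ⟨f, k, j⟩ x
    have h1 := hS.mem f k (φ x)
    have h2 := (hT f).mem e j x
    simp only [StarAlgHom.comp_apply] at h2 ⊢
    rw [← Matrix.mul_assoc, h1, Matrix.mul_assoc, h2, Matrix.mul_assoc]
  · rintro e ⟨f, k, j⟩
    simp only [Matrix.conjTranspose_mul]
    rw [Matrix.mul_assoc, ← Matrix.mul_assoc _ (S f k), hS.orth_self, Matrix.one_mul,
      (hT f).orth_self]
  · rintro e ⟨f, k, j⟩ ⟨f', k', j'⟩ hne
    simp only [Matrix.conjTranspose_mul]
    rw [Matrix.mul_assoc, ← Matrix.mul_assoc _ (S f' k')]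
    by_cases hf : f = f'
    · subst hf
      by_cases hk : k = k'
      · subst hk
        rw [hS.orth_self, Matrix.one_mul, (hT f).orth_ne]
        rintro rfl
        exact hne rfl
      · rw [hS.orth_ne f k k' hk, Matrix.zero_mul, Matrix.mul_zero]
    · rw [conjTranspose_mul_eq_zero hG hf (hS.mem _ _) (hS.mem _ _), Matrix.zero_mul,
        Matrix.mul_zero]
  · have h1 : ∀ e : MinProj F, ∑ r : (Σ f, K f × J f e), S r.1 r.2.1 * T r.1 e r.2.2 *
        (S r.1 r.2.1 * T r.1 e r.2.2)ᴴ
        = ∑ f, ∑ k, S f k * (∑ j, T f e j * (T f e j)ᴴ) * (S f k)ᴴ := by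
      intro e
      rw [Fintype.sum_sigma]
      refine Finset.sum_congr rfl fun f _ => ?_
      rw [Fintype.sum_prod_type]
      refine Finset.sum_congr rfl fun k _ => ?_
      simp only [Matrix.mul_sum, Matrix.sum_mul, Matrix.conjTranspose_mul, Matrix.mul_assoc]
    simp only [h1]
    rw [Finset.sum_comm, ← hS.complete]
    refine Finset.sum_congr rfl fun f _ => ?_
    rw [Finset.sum_comm]
    refine Finset.sum_congr rfl fun k _ => ?_
    rw [← Matrix.sum_mul, ← Matrix.mul_sum, (hT f).complete, Matrix.mul_one]

end IsDecomp

/-- The direct sum of `c e` copies of each block, placed on `Fin m` through a bijection `ε` of index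
sets; the `T e r` are coordinate embeddings. -/
theorem exists_rep_isDecomp {m : ℕ} (c : MinProj F → ℕ)
    (hc : ∑ e, c e * dimVec F e = m) :
    ∃ (σ : F →⋆ₐ[ℂ] Matrix (Fin m) (Fin m) ℂ) (T : _), IsDecomp σ (fun e => Fin (c e)) T := by
  classical
  have hcard : Fintype.card (Σ e : MinProj F, Fin (c e) × Fin (blockRep e).1) = m := by
    rw [← hc, Fintype.card_sigma]
    simp only [Fintype.card_prod, Fintype.card_fin]
    rfl
  let ε := Fintype.equivFinOfCardEq hcard
  let T : ∀ e, Fin (c e) → Matrix (Fin m) (Fin (blockRep e).1) ℂ := fun e r =>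
    Matrix.of fun i a => if ε ⟨e, r, a⟩ = i then 1 else 0
  have hTT : ∀ e r f s a b, ((T e r)ᴴ * T f s) a b =
      if (⟨e, r, a⟩ : Σ e : MinProj F, Fin (c e) × Fin (blockRep e).1) = ⟨f, s, b⟩ then 1
      else 0 := by
    intro e r f s a b
    simp only [T, Matrix.mul_apply, Matrix.conjTranspose_apply, Matrix.of_apply]
    simp only [apply_ite star, star_one, star_zero, ite_mul, one_mul, zero_mul, Finset.sum_ite_eq,
      Finset.mem_univ, if_true, ε.apply_eq_iff_eq]
    simp only [eq_comm]
  have h1 : ∀ e r, (T e r)ᴴ * T e r = 1 := by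
    intro e r
    ext a b
    rw [hTT, Matrix.one_apply]
    simp
  have h2 : ∀ e r s, r ≠ s → (T e r)ᴴ * T e s = 0 := by
    intro e r s h
    ext a b
    rw [hTT]
    simp [h]
  have h3 : ∀ e f r s, e ≠ f → (T e r)ᴴ * T f s = 0 := by
    intro e f r s h
    ext a b
    rw [hTT]
    simp [h]
  have h4 : ∑ e, ∑ r, T e r * (T e r)ᴴ = 1 := by
    ext i j
    have : ∀ e r, (T e r * (T e r)ᴴ) i j
        = ∑ a, if ε ⟨e, r, a⟩ = i then (if i = j then 1 else 0) else 0 := by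
      intro e r
      simp only [T, Matrix.mul_apply, Matrix.conjTranspose_apply, Matrix.of_apply]
      refine Finset.sum_congr rfl fun a _ => ?_
      by_cases h : ε ⟨e, r, a⟩ = i
      · simp [h, apply_ite star]
      · simp [h]
    simp only [Matrix.sum_apply, this, Matrix.one_apply]
    have h5 : ∑ x : (Σ e : MinProj F, Fin (c e) × Fin (blockRep e).1),
        (if ε x = i then (if i = j then (1 : ℂ) else 0) else 0) = if i = j then 1 else 0 := by
      rw [Finset.sum_eq_single (ε.symm i)]
      · simp
      · intro x _ hx
        rw [if_neg]
        rintro rfl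
        simp at hx
      · simp
    rw [Fintype.sum_sigma] at h5
    simp only [Fintype.sum_prod_type] at h5
    exact h5
  have hmulT : ∀ x e r, (∑ f, ∑ s, T f s * (blockRep f).2 x * (T f s)ᴴ) * T e r
      = T e r * (blockRep e).2 x := by
    intro x e r
    rw [Matrix.sum_mul, Finset.sum_eq_single e, Matrix.sum_mul, Finset.sum_eq_single r]
    · rw [Matrix.mul_assoc, h1, Matrix.mul_one]
    · intro s _ hs
      rw [Matrix.mul_assoc, h2 e s r hs, Matrix.mul_zero]
    · simp
    · intro f _ hf
      rw [Matrix.sum_mul]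
      exact Finset.sum_eq_zero fun s _ => by rw [Matrix.mul_assoc, h3 _ _ _ _ hf, Matrix.mul_zero]
    · simp
  let σ : F →⋆ₐ[ℂ] Matrix (Fin m) (Fin m) ℂ :=
    { toFun := fun x => ∑ f, ∑ s, T f s * (blockRep f).2 x * (T f s)ᴴ
      map_one' := by simp only [map_one, Matrix.mul_one, h4]
      map_mul' := fun x y => by
        conv_rhs => rw [Matrix.mul_sum]
        refine Finset.sum_congr rfl fun e _ => ?_
        rw [Matrix.mul_sum]
        refine Finset.sum_congr rfl fun r _ => ?_
        rw [← Matrix.mul_assoc, ← Matrix.mul_assoc, hmulT, map_mul]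
        simp only [Matrix.mul_assoc]
      map_zero' := by simp
      map_add' := fun x y => by
        simp only [map_add, Matrix.mul_add, Matrix.add_mul, Finset.sum_add_distrib]
      commutes' := fun z => by
        simp only [Algebra.algebraMap_eq_smul_one, map_smul, map_one, Matrix.mul_smul,
          Matrix.smul_mul, Matrix.mul_one, ← Finset.smul_sum, h4]
      map_star' := fun x => by
        simp [Matrix.star_eq_conjTranspose, map_star, Matrix.mul_assoc] }
  exact ⟨σ, T, fun e r x => hmulT x e r, h1, h2, h4⟩

end Decomp

/-! ### Morphisms of finite dimensional algebras and their mapping matrices. -/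

section MappingMatrix

variable {F G : Type*} [Ring F] [StarRing F] [Algebra ℂ F] [FiniteDimensional ℂ F]
  [Ring G] [StarRing G] [Algebra ℂ G] [FiniteDimensional ℂ G]

theorem mappingMatrix_comp {H : Type*} [Ring H] [StarRing H] [Algebra ℂ H]
    (hF : HasBlocks F) (hG : HasBlocks G) (ψ : G →⋆ₐ[ℂ] H) (φ : F →⋆ₐ[ℂ] G) :
    mappingMatrix (ψ.comp φ) = mappingMatrix ψ * mappingMatrix φ := by
  ext f e
  obtain ⟨S, hS⟩ := exists_isDecomp hG ((blockRep f).2.comp ψ)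
  choose T hT using fun g : MinProj G => exists_isDecomp hF ((blockRep g).2.comp φ)
  have h := (hS.comp φ hT hG).multiplicity_eq hF e
  rw [Fintype.card_sigma] at h
  simp only [Fintype.card_prod, Fintype.card_fin] at h
  exact h

omit [FiniteDimensional ℂ G] in
theorem mappingMatrix_mulVec (hF : HasBlocks F) (φ : F →⋆ₐ[ℂ] G) :
    mappingMatrix φ *ᵥ dimVec F = dimVec G := by
  ext f
  obtain ⟨T, hT⟩ := exists_isDecomp hF ((blockRep f).2.comp φ)
  have h := hT.sum_card_mul
  simp only [Fintype.card_fin] at h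
  exact h

/-- A zero row would force the corresponding block of `G` to have size zero. -/
theorem isMappingMatrix_mappingMatrix (hF : HasBlocks F) (hG : HasBlocks G) (φ : F →⋆ₐ[ℂ] G) :
    IsMappingMatrix (mappingMatrix φ) := by
  intro f
  by_contra! h
  have h1 := congrFun (mappingMatrix_mulVec hF φ) f
  have h2 := hG.dimVec_pos f
  rw [← h1, Matrix.mulVec, dotProduct, Finset.sum_eq_zero] at h2
  · exact lt_irrefl _ h2
  · intro e _
    rw [Nat.le_zero.mp (h e), zero_mul]

-- Multiplication by the images of `s⁻¹` and `s` gives inverse isomorphisms of the intertwiner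
-- spaces. Since only dimensions are compared, `s` need not be unitary.
omit [FiniteDimensional ℂ F] [FiniteDimensional ℂ G] in
theorem mappingMatrix_eq_of_intertwiner {φ ψ : F →⋆ₐ[ℂ] G} {s : G} (hs : IsUnit s)
    (h : ∀ x, φ x * s = s * ψ x) : mappingMatrix φ = mappingMatrix ψ := by
  obtain ⟨⟨s, t, hst, hts⟩, rfl⟩ := hs
  simp only at h
  have h' : ∀ x, ψ x * t = t * φ x := fun x => by
    calc ψ x * t = t * s * (ψ x * t) := by rw [hts, one_mul]
      _ = t * (s * ψ x) * t := by simp only [mul_assoc]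
      _ = t * φ x := by rw [← h]; simp only [mul_assoc, hst, mul_one]
  ext f e
  have h1 : (blockRep f).2 s * (blockRep f).2 t = 1 := by rw [← map_mul, hst, map_one]
  have h2 : (blockRep f).2 t * (blockRep f).2 s = 1 := by rw [← map_mul, hts, map_one]
  refine LinearEquiv.finrank_eq (LinearEquiv.ofLinearMap
    (LinearMap.restrict (mulLeftLinearMap _ ℂ ((blockRep f).2 t)) ?_)
    (LinearMap.restrict (mulLeftLinearMap _ ℂ ((blockRep f).2 s)) ?_) ?_ ?_)
  · intro T hT x
    have := hT x
    simp only [StarAlgHom.comp_apply, mulLeftLinearMap_apply] at this ⊢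
    rw [← Matrix.mul_assoc, ← map_mul, h', map_mul, Matrix.mul_assoc, this, Matrix.mul_assoc]
  · intro T hT x
    have := hT x
    simp only [StarAlgHom.comp_apply, mulLeftLinearMap_apply] at this ⊢
    rw [← Matrix.mul_assoc, ← map_mul, h, map_mul, Matrix.mul_assoc, this, Matrix.mul_assoc]
  · ext1 T
    apply Subtype.ext
    change (blockRep f).2 t * ((blockRep f).2 s * T.1) = T.1
    rw [← Matrix.mul_assoc, h2, Matrix.one_mul]
  · ext1 T
    apply Subtype.ext
    change (blockRep f).2 s * ((blockRep f).2 t * T.1) = T.1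
    rw [← Matrix.mul_assoc, h1, Matrix.one_mul]

omit [FiniteDimensional ℂ G] in
theorem exists_unitary_of_multiplicity_eq (hF : HasBlocks F) {m : ℕ}
    {σ τ : F →⋆ₐ[ℂ] Matrix (Fin m) (Fin m) ℂ}
    (h : ∀ e : MinProj F, multiplicity (blockRep e).2 σ = multiplicity (blockRep e).2 τ) :
    ∃ u ∈ unitary (Matrix (Fin m) (Fin m) ℂ), ∀ x, σ x = star u * τ x * u := by
  obtain ⟨S, hS⟩ := exists_isDecomp hF σ
  have hτ : ∃ T, IsDecomp τ (fun e => Fin (multiplicity (blockRep e).2 σ)) T := by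
    obtain ⟨T, hT⟩ := exists_isDecomp hF τ
    -- The count is generalised to a variable `c` so that the index types of the two decompositions
    -- become literally the same.
    have aux : ∀ c : MinProj F → ℕ, (fun e => multiplicity (blockRep e).2 τ) = c →
        ∃ T', IsDecomp τ (fun e => Fin (c e)) T' := by
      rintro c rfl
      exact ⟨T, hT⟩
    exact aux _ (funext fun e => (h e).symm)
  obtain ⟨T, hT⟩ := hτ
  exact hS.exists_unitary hF hT

theorem exists_unitary_of_mappingMatrix_eq (hF : HasBlocks F) (hG : HasBlocks G)
    {φ ψ : F →⋆ₐ[ℂ] G} (h : mappingMatrix φ = mappingMatrix ψ) :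
    ∃ u ∈ unitary G, ∀ x, φ x = star u * ψ x * u := by
  have key : ∀ f : MinProj G, ∃ u ∈ unitary (Matrix (Fin (blockRep f).1) (Fin (blockRep f).1) ℂ),
      ∀ x, (blockRep f).2 (φ x) = star u * (blockRep f).2 (ψ x) * u := by
    intro f
    exact exists_unitary_of_multiplicity_eq hF fun e => congrFun (congrFun h f) e
  choose u hu hφ using key
  refine ⟨hG.equivBlocks.symm u, ?_, fun x => hG.ext_blockRep fun f => ?_⟩
  · rw [Unitary.mem_iff]
    constructor <;> refine hG.ext_blockRep fun f => ?_
    · rw [map_mul, map_star, hG.blockRep_equivBlocks_symm, map_one]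
      exact (Unitary.mem_iff.mp (hu f)).1
    · rw [map_mul, map_star, hG.blockRep_equivBlocks_symm, map_one]
      exact (Unitary.mem_iff.mp (hu f)).2
  · rw [map_mul, map_mul, map_star, hG.blockRep_equivBlocks_symm]
    exact hφ f x

theorem exists_mappingMatrix_eq (hF : HasBlocks F) (hG : HasBlocks G)
    {Γ : Matrix (MinProj G) (MinProj F) ℕ} (h : Γ *ᵥ dimVec F = dimVec G) :
    ∃ φ : F →⋆ₐ[ℂ] G, mappingMatrix φ = Γ := by
  choose σ T hσ using fun f : MinProj G => exists_rep_isDecomp (F := F) (Γ f) (congrFun h f)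
  let τ : F →⋆ₐ[ℂ] (∀ f : MinProj G, Matrix (Fin (blockRep f).1) (Fin (blockRep f).1) ℂ) :=
    { toFun := fun x f => σ f x
      map_one' := funext fun _ => map_one _
      map_mul' := fun x y => funext fun _ => map_mul _ x y
      map_zero' := funext fun _ => map_zero _
      map_add' := fun x y => funext fun _ => map_add _ x y
      commutes' := fun c => funext fun _ => AlgHomClass.commutes _ c
      map_star' := fun x => funext fun _ => map_star _ x }
  refine ⟨(hG.equivBlocks.symm : _ →⋆ₐ[ℂ] G).comp τ, ?_⟩
  ext f e
  have h1 : (blockRep f).2.comp ((hG.equivBlocks.symm : _ →⋆ₐ[ℂ] G).comp τ) = σ f := by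
    ext1 x
    exact hG.blockRep_equivBlocks_symm (τ x) f
  have h2 := (hσ f).multiplicity_eq hF e
  rw [Fintype.card_fin] at h2
  change multiplicity _ ((blockRep f).2.comp _) = _
  rw [h1]
  exact h2

end MappingMatrix

/-! ### Functional calculus estimates. -/

section Perturbation

variable {G : Type*} [CStarAlgebra G]

theorem norm_one_le : ‖(1 : G)‖ ≤ 1 := by
  rcases subsingleton_or_nontrivial G with h | h
  · rw [Subsingleton.elim (1 : G) 0, norm_zero]
    exact zero_le_one
  · exact CStarRing.norm_one.le

theorem norm_le_one_of_isStarProjection {p : G} (hp : IsStarProjection p) : ‖p‖ ≤ 1 := by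
  have h : ‖p‖ = ‖p‖ * ‖p‖ := by
    rw [← CStarRing.norm_star_mul_self, hp.isSelfAdjoint.star_eq, hp.isIdempotentElem.eq]
  by_contra! h1
  nlinarith

theorem _root_.IsStarProjection.eq_zero_of_norm_lt_one {p : G} (hp : IsStarProjection p)
    (h1 : ‖p‖ < 1) : p = 0 := by
  have h : ‖p‖ = ‖p‖ * ‖p‖ := by
    rw [← CStarRing.norm_star_mul_self, hp.isSelfAdjoint.star_eq, hp.isIdempotentElem.eq]
  by_contra h2
  have := norm_pos_iff.mpr h2
  nlinarith

/-- `r` is `w^{-1/2}`; the spectrum of `w` stays above `1/2`. -/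
theorem exists_inv_sqrt (w : G) (hw : IsSelfAdjoint w) (h : ‖w - 1‖ ≤ 1 / 2) :
    ∃ r : G, IsSelfAdjoint r ∧ r * w * r = 1 ∧ ‖r - 1‖ ≤ ‖w - 1‖ ∧
      ∀ c, Commute w c → Commute r c := by
  have hspec : ∀ t ∈ spectrum ℝ w, |t - 1| ≤ ‖w - 1‖ := by
    intro t ht
    have h1 := norm_apply_le_norm_cfc (fun t : ℝ => t - 1) w ht (by fun_prop) hw
    rwa [cfc_sub (fun t => t) (fun _ => 1) w (by fun_prop) (by fun_prop), cfc_id' ℝ w,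
      cfc_const_one ℝ w, Real.norm_eq_abs] at h1
  have hpos : ∀ t ∈ spectrum ℝ w, 1 / 2 ≤ t := fun t ht => by
    have := (abs_le.mp ((hspec t ht).trans h)).1
    linarith
  have hc : ContinuousOn (fun t : ℝ => (√t)⁻¹) (spectrum ℝ w) := by
    refine ContinuousOn.inv₀ (by fun_prop) fun t ht => ?_
    have := hpos t ht
    positivity
  refine ⟨cfc (fun t : ℝ => (√t)⁻¹) w, cfc_predicate _ _, ?_, ?_, fun c hwc => ?_⟩
  · nth_rw 2 [← cfc_id' ℝ w]
    rw [← cfc_mul _ _ w hc (by fun_prop), ← cfc_mul _ _ w (by fun_prop) hc, ← cfc_const_one ℝ w]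
    refine cfc_congr fun t ht => ?_
    have := hpos t ht
    have h1 : 0 < √t := Real.sqrt_pos.mpr (by linarith)
    have h2 : √t * √t = t := Real.mul_self_sqrt (by linarith)
    field_simp
    nlinarith
  · rw [← cfc_const_one ℝ w, ← cfc_sub _ _ w hc (by fun_prop)]
    refine norm_cfc_le (norm_nonneg _) fun t ht => ?_
    rw [cfc_const_one ℝ w]
    refine le_trans ?_ (hspec t ht)
    have h0 := hpos t ht
    have h1 : 1 / 2 ≤ √t := by
      rw [Real.le_sqrt (by norm_num) (by linarith)]
      linarith
    have h2 : √t * √t = t := Real.mul_self_sqrt (by linarith)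
    -- The extra factor is at most `1`, because `t ≥ 1/2` and `√t ≥ 1/2` give `√t (1 + √t) ≥ 1`.
    have h4 : (√t)⁻¹ - 1 = (1 - t) * ((√t)⁻¹ * (1 + √t)⁻¹) := by
      field_simp
      nlinarith
    rw [Real.norm_eq_abs, h4, abs_mul, abs_sub_comm]
    refine mul_le_of_le_one_right (abs_nonneg _) ?_
    rw [← mul_inv, abs_of_pos (by positivity)]
    refine inv_le_one_of_one_le₀ ?_
    nlinarith
  · exact hwc.cfc_real _

/-- Rounding `t` to `0` or `1` at the threshold `1/2` moves it by one factor of `|t| |t - 1|`, while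
the other factor is at least `1/2`. -/
theorem norm_cfc_indicator_sub_le [FiniteDimensional ℂ G] {a : G} (ha : IsSelfAdjoint a) :
    ‖cfc ((Set.Ioi (1 / 2 : ℝ)).indicator 1) a - a‖ ≤ 2 * ‖a * a - a‖ := by
  have hc := fun f : ℝ → ℝ => continuousOn_spectrum f a
  have h1 : ∀ t ∈ spectrum ℝ a, |t * t - t| ≤ ‖a * a - a‖ := by
    intro t ht
    have := norm_apply_le_norm_cfc (fun t : ℝ => t * t - t) a ht (hc _) ha
    rwa [cfc_sub (fun t => t * t) (fun t => t) a (hc _) (hc _), cfc_mul _ _ a (hc _) (hc _),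
      cfc_id' ℝ a] at this
  conv_lhs => enter [1, 2]; rw [← cfc_id' ℝ a]
  rw [← cfc_sub _ _ a (hc _) (hc _)]
  refine norm_cfc_le (by positivity) fun t ht => ?_
  refine le_trans ?_ (mul_le_mul_of_nonneg_left (h1 t ht) zero_le_two)
  rw [show t * t - t = t * (t - 1) by ring, abs_mul, Real.norm_eq_abs]
  by_cases h : 1 / 2 < t
  · rw [Set.indicator_of_mem (by exact h), Pi.one_apply, abs_sub_comm, abs_of_pos (a := t) (by linarith)]
    nlinarith [abs_nonneg (t - 1)]
  · rw [Set.indicator_of_notMem (by exact h), zero_sub, abs_neg, abs_of_nonpos (a := t - 1) (by linarith)]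
    nlinarith [abs_nonneg t]

/-- The indicator vanishes near `0`, so the spectral projection is `a` times another function of
`a`. -/
theorem mul_cfc_indicator_eq_zero [FiniteDimensional ℂ G] {a s : G} (ha : IsSelfAdjoint a)
    (h : s * a = 0) : s * cfc ((Set.Ioi (1 / 2 : ℝ)).indicator 1) a = 0 := by
  have hc := fun f : ℝ → ℝ => continuousOn_spectrum f a
  have h1 : cfc ((Set.Ioi (1 / 2 : ℝ)).indicator 1) a
      = a * cfc ((Set.Ioi (1 / 2 : ℝ)).indicator fun t => t⁻¹) a := by
    nth_rw 2 [← cfc_id' ℝ a]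
    rw [← cfc_mul _ _ a (hc _) (hc _)]
    congr 1
    funext t
    by_cases h : 1 / 2 < t
    · rw [Set.indicator_of_mem (by exact h), Set.indicator_of_mem (by exact h), Pi.one_apply,
        mul_inv_cancel₀ (by linarith)]
    · rw [Set.indicator_of_notMem (by exact h), Set.indicator_of_notMem (by exact h), mul_zero]
  rw [h1, ← mul_assoc, h, zero_mul]

end Perturbation

/-! ### Lifting projections and partial isometries from the ultraproduct. -/

section Lifts

variable {I : Type*} {U : Ultrafilter I} {B : I → Type*} [∀ i, CStarAlgebra (B i)]

theorem eventually_norm_sub_lt {x y : boundedFamilies B}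
    (h : Ultraproduct.mk U B x = Ultraproduct.mk U B y) {ε : ℝ} (hε : 0 < ε) :
    ∀ᶠ i in (U : Filter I), ‖x.1 i - y.1 i‖ < ε :=
  ((Ultraproduct.mk_eq_mk U B).mp h).eventually (gt_mem_nhds hε)

theorem eventually_isUnit {x y : boundedFamilies B}
    (h : Ultraproduct.mk U B x * Ultraproduct.mk U B y = 1)
    (h' : Ultraproduct.mk U B y * Ultraproduct.mk U B x = 1) :
    ∀ᶠ i in (U : Filter I), IsUnit (x.1 i) := by
  rw [← map_mul, ← map_one (Ultraproduct.mk U B)] at h h'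
  filter_upwards [eventually_norm_sub_lt h one_pos, eventually_norm_sub_lt h' one_pos] with i h1 h2
  have h3 : IsUnit (x.1 i * y.1 i) := by
    have := isUnit_one_sub_of_norm_lt_one (x := 1 - x.1 i * y.1 i) (by rw [norm_sub_rev]; exact h1)
    rwa [sub_sub_cancel] at this
  have h4 : IsUnit (y.1 i * x.1 i) := by
    have := isUnit_one_sub_of_norm_lt_one (x := 1 - y.1 i * x.1 i) (by rw [norm_sub_rev]; exact h2)
    rwa [sub_sub_cancel] at this
  obtain ⟨a, ha⟩ := h3.exists_right_inv
  obtain ⟨b, hb⟩ := h4.exists_left_inv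
  rw [mul_assoc] at ha
  rw [← mul_assoc] at hb
  have := left_inv_eq_right_inv hb ha
  exact ⟨⟨x.1 i, y.1 i * a, ha, by rw [← this, hb]⟩, rfl⟩

/-- A self-adjoint lift is compressed by `1 - s` and then rounded to a spectral projection. The
compression makes orthogonality to `s` exact at every index, as the induction over several
projections needs. -/
theorem exists_lift_projection [∀ i, FiniteDimensional ℂ (B i)] {q : Ultraproduct U B}
    (hq : IsStarProjection q) {s : boundedFamilies B} (hs : ∀ i, IsStarProjection (s.1 i))
    (hsq : Ultraproduct.mk U B s * q = 0) :
    ∃ p : boundedFamilies B, Ultraproduct.mk U B p = q ∧ (∀ i, IsStarProjection (p.1 i)) ∧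
      ∀ i, s.1 i * p.1 i = 0 := by
  obtain ⟨y, hy⟩ := Ultraproduct.mk_surjective U B q
  have hss : star s = s := Subtype.ext (funext fun i => (hs i).isSelfAdjoint.star_eq)
  have hqs : q * Ultraproduct.mk U B s = 0 := by
    have := congrArg star hsq
    rwa [star_mul, Ultraproduct.star_mk, hss, hq.isSelfAdjoint.star_eq, star_zero] at this
  let z : boundedFamilies B := (1 - s) * ((2 : ℂ)⁻¹ • (y + star y)) * (1 - s)
  have hz : Ultraproduct.mk U B z = q := by
    have h1 : (2 : ℂ)⁻¹ • (q + q) = q := by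
      rw [← two_smul ℂ q, smul_smul, inv_mul_cancel₀ two_ne_zero, one_smul]
    simp only [z, map_mul, map_sub, map_one, map_smul, map_add, ← Ultraproduct.star_mk, hy,
      hq.isSelfAdjoint.star_eq, h1]
    rw [sub_mul, hsq, one_mul, sub_zero, mul_sub, hqs, mul_one, sub_zero]
  have hzs : ∀ i, IsSelfAdjoint (z.1 i) := by
    intro i
    have h1 : IsSelfAdjoint ((2 : ℂ)⁻¹ • (y.1 i + star (y.1 i))) := by
      rw [isSelfAdjoint_iff, star_smul, star_add, star_star, add_comm]
      simp
    have h2 : star (1 - s.1 i) = 1 - s.1 i := (hs i).one_sub.isSelfAdjoint.star_eq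
    have h3 := h1.conjugate (1 - s.1 i)
    rwa [h2] at h3
  have hsz : ∀ i, s.1 i * z.1 i = 0 := by
    intro i
    change s.1 i * ((1 - s.1 i) * _ * _) = 0
    rw [← mul_assoc, ← mul_assoc, (hs i).mul_one_sub_self, zero_mul, zero_mul]
  have hp : ∀ i, IsStarProjection (cfc ((Set.Ioi (1 / 2 : ℝ)).indicator 1) (z.1 i)) := fun i =>
    isStarProjection_cfc_indicator _ _
  refine ⟨⟨fun i => cfc ((Set.Ioi (1 / 2 : ℝ)).indicator 1) (z.1 i), 1, fun i =>
    norm_le_one_of_isStarProjection (hp i)⟩, ?_, hp, fun i => mul_cfc_indicator_eq_zero (hzs i) (hsz i)⟩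
  rw [← hz, Ultraproduct.mk_eq_mk]
  have h1 : Ultraproduct.mk U B (z * z) = Ultraproduct.mk U B z := by
    rw [map_mul, hz, hq.isIdempotentElem.eq]
  rw [Ultraproduct.mk_eq_mk] at h1
  exact squeeze_zero (fun i => norm_nonneg _) (fun i => norm_cfc_indicator_sub_le (hzs i))
    (by simpa using h1.const_mul 2)

theorem exists_lift_projections [∀ i, FiniteDimensional ℂ (B i)] {ι : Type*} (s : Finset ι)
    (q : ι → Ultraproduct U B) (hq : ∀ j, IsStarProjection (q j))
    (horth : ∀ j k, j ≠ k → q j * q k = 0) :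
    ∃ p : ι → boundedFamilies B, (∀ j ∈ s, Ultraproduct.mk U B (p j) = q j) ∧
      (∀ j ∈ s, ∀ i, IsStarProjection ((p j).1 i)) ∧
      ∀ j ∈ s, ∀ k ∈ s, j ≠ k → ∀ i, (p j).1 i * (p k).1 i = 0 := by
  classical
  induction s using Finset.induction_on with
  | empty => exact ⟨fun _ => 0, by simp, by simp, by simp⟩
  | insert a s ha ih =>
    obtain ⟨p, h1, h2, h3⟩ := ih
    have hval : ∀ i, (∑ j ∈ s, p j : boundedFamilies B).1 i = ∑ j ∈ s, (p j).1 i := by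
      intro i
      rw [AddSubmonoidClass.coe_finsetSum, Finset.sum_apply]
    have hmul : ∀ j ∈ s, ∀ i, (p j).1 i * ∑ k ∈ s, (p k).1 i = (p j).1 i := by
      intro j hj i
      rw [Finset.mul_sum, Finset.sum_eq_single_of_mem j hj]
      · exact (h2 j hj i).isIdempotentElem.eq
      · intro k hk hkj
        exact h3 j hj k hk hkj.symm i
    have hS : ∀ i, IsStarProjection ((∑ j ∈ s, p j : boundedFamilies B).1 i) := by
      intro i
      rw [hval]
      refine ⟨?_, isSelfAdjoint_sum _ fun j hj => (h2 j hj i).isSelfAdjoint⟩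
      rw [IsIdempotentElem, Finset.sum_mul]
      exact Finset.sum_congr rfl fun j hj => hmul j hj i
    obtain ⟨r, hr1, hr2, hr3⟩ := exists_lift_projection (hq a) hS (by
      rw [map_sum, Finset.sum_mul]
      refine Finset.sum_eq_zero fun j hj => ?_
      rw [h1 j hj, horth]
      rintro rfl
      exact ha hj)
    have hr4 : ∀ j ∈ s, ∀ i, (p j).1 i * r.1 i = 0 := by
      intro j hj i
      have := hr3 i
      rw [hval] at this
      rw [← hmul j hj i, mul_assoc, this, mul_zero]
    have hr5 : ∀ j ∈ s, ∀ i, r.1 i * (p j).1 i = 0 := by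
      intro j hj i
      have := congrArg star (hr4 j hj i)
      rwa [star_mul, (hr2 i).isSelfAdjoint.star_eq, (h2 j hj i).isSelfAdjoint.star_eq,
        star_zero] at this
    have hne : ∀ j ∈ s, j ≠ a := by
      rintro j hj rfl
      exact ha hj
    refine ⟨Function.update p a r, ?_, ?_, ?_⟩
    · intro j hj
      rcases Finset.mem_insert.mp hj with rfl | hj
      · simpa using hr1
      · simpa [hne j hj] using h1 j hj
    · intro j hj
      rcases Finset.mem_insert.mp hj with rfl | hj
      · simpa using hr2
      · simpa [hne j hj] using h2 j hj
    · intro j hj k hk hjk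
      rcases Finset.mem_insert.mp hj with hja | hj <;>
        rcases Finset.mem_insert.mp hk with hka | hk
      · exact absurd (hja.trans hka.symm) hjk
      · simpa [hja, hne k hk] using hr5 k hk
      · simpa [hka, hne j hj] using hr4 j hj
      · simpa [hne j hj, hne k hk] using h3 j hj k hk hjk

/-- Cut a lift down to `z = q y p` and take its polar part. Then `star v * v = p` exactly, and `v *
star v` is a subprojection of `q` at distance less than `1`, hence `q`. -/
theorem exists_lift_partialIsometry {p q : boundedFamilies B}
    (hp : ∀ i, IsStarProjection (p.1 i)) (hq : ∀ i, IsStarProjection (q.1 i))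
    {V : Ultraproduct U B} (hV : star V * V = Ultraproduct.mk U B p)
    (hV' : V * star V = Ultraproduct.mk U B q) (hVp : V * Ultraproduct.mk U B p = V) :
    ∃ v : boundedFamilies B, Ultraproduct.mk U B v = V ∧
      ∀ᶠ i in (U : Filter I), star (v.1 i) * v.1 i = p.1 i ∧ v.1 i * star (v.1 i) = q.1 i ∧
        v.1 i * p.1 i = v.1 i := by
  obtain ⟨y, hy⟩ := Ultraproduct.mk_surjective U B V
  let z : boundedFamilies B := q * y * p
  have hz : Ultraproduct.mk U B z = V := by
    simp only [z, map_mul, hy]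
    rw [← hV', mul_assoc, hVp, mul_assoc, hV, hVp]
  have hzp : ∀ i, z.1 i * p.1 i = z.1 i := fun i => by
    change q.1 i * y.1 i * p.1 i * p.1 i = _
    rw [mul_assoc, (hp i).isIdempotentElem.eq]; rfl
  have hqz : ∀ i, q.1 i * z.1 i = z.1 i := fun i => by
    change q.1 i * (q.1 i * y.1 i * p.1 i) = _
    rw [← mul_assoc, ← mul_assoc, (hq i).isIdempotentElem.eq]; rfl
  have hpz : ∀ i, p.1 i * star (z.1 i) = star (z.1 i) := fun i => by
    have := congrArg star (hzp i)
    rwa [star_mul, (hp i).isSelfAdjoint.star_eq] at this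
  -- The summand `1 - p` makes `w` close to `1` in the whole algebra, so that `w^{-1/2}` exists; on
  -- the range of `p` it is the inverse of `|z|`.
  let w : boundedFamilies B := star z * z + (1 - p)
  have hw : Ultraproduct.mk U B w = Ultraproduct.mk U B 1 := by
    simp only [w, map_add, map_mul, map_sub, map_one, ← Ultraproduct.star_mk, hz, hV]
    abel
  have hwi : ∀ i, w.1 i = star (z.1 i) * z.1 i + (1 - p.1 i) := fun i => rfl
  have hws : ∀ i, IsSelfAdjoint (w.1 i) := fun i =>
    (IsSelfAdjoint.star_mul_self _).add (hp i).one_sub.isSelfAdjoint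
  have hwp : ∀ i, w.1 i * p.1 i = star (z.1 i) * z.1 i := fun i => by
    rw [hwi, add_mul, mul_assoc, hzp, (hp i).one_sub_mul_self, add_zero]
  have hpw : ∀ i, p.1 i * w.1 i = star (z.1 i) * z.1 i := fun i => by
    rw [hwi, mul_add, ← mul_assoc, hpz, (hp i).mul_one_sub_self, add_zero]
  choose r hr1 hr2 hr3 hr4 using fun i (h : ‖w.1 i - 1‖ ≤ 1 / 2) => exists_inv_sqrt (w.1 i) (hws i) h
  classical
  -- The default value `1` keeps `‖R - 1‖ ≤ ‖w - 1‖` valid at every index; the bound `2` is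
  -- generous.
  let R : boundedFamilies B := ⟨fun i => if h : ‖w.1 i - 1‖ ≤ 1 / 2 then r i h else 1, 2, fun i => by
    beta_reduce
    by_cases h : ‖w.1 i - 1‖ ≤ 1 / 2
    · rw [dif_pos h, ← sub_add_cancel (r i h) 1]
      refine (norm_add_le _ _).trans ?_
      linarith [hr3 i h, norm_one_le (G := B i)]
    · rw [dif_neg h]
      exact norm_one_le.trans one_le_two⟩
  have hR : Ultraproduct.mk U B R = Ultraproduct.mk U B 1 := by
    rw [Ultraproduct.mk_eq_mk] at hw ⊢
    refine squeeze_zero (fun i => norm_nonneg _) (fun i => ?_) hw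
    simp only [R]
    by_cases h : ‖w.1 i - 1‖ ≤ 1 / 2
    · rw [dif_pos h]
      exact hr3 i h
    · rw [dif_neg h]
      change ‖(1 : B i) - 1‖ ≤ _
      simp
  have hv : Ultraproduct.mk U B (z * R) = V := by rw [map_mul, hR, map_one, mul_one, hz]
  refine ⟨z * R, hv, ?_⟩
  have hvq : Ultraproduct.mk U B (q - z * R * star (z * R)) = Ultraproduct.mk U B 0 := by
    rw [map_sub, map_mul, ← Ultraproduct.star_mk, hv, hV', sub_self, map_zero]
  filter_upwards [eventually_norm_sub_lt hw one_half_pos, eventually_norm_sub_lt hvq one_pos]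
    with i hi1 hi2
  have hi : ‖w.1 i - 1‖ ≤ 1 / 2 := hi1.le
  have hRi : R.1 i = r i hi := dif_pos hi
  have hvi : (z * R).1 i = z.1 i * r i hi := by rw [← hRi]; rfl
  have hrp : r i hi * p.1 i = p.1 i * r i hi := hr4 i hi _ ((hwp i).trans (hpw i).symm)
  have hrs : star (r i hi) = r i hi := hr1 i hi
  have h1 : star (z.1 i * r i hi) * (z.1 i * r i hi) = p.1 i := by
    calc star (z.1 i * r i hi) * (z.1 i * r i hi)
        = r i hi * (star (z.1 i) * z.1 i) * r i hi := by rw [star_mul, hrs]; simp only [mul_assoc]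
      _ = r i hi * w.1 i * r i hi * p.1 i := by
        rw [← hwp]
        simp only [mul_assoc, hrp]
      _ = p.1 i := by rw [hr2, one_mul]
  have h2 : z.1 i * r i hi * p.1 i = z.1 i * r i hi := by
    rw [mul_assoc, hrp, ← mul_assoc, hzp]
  have hproj : IsStarProjection (z.1 i * r i hi * star (z.1 i * r i hi)) := by
    refine ⟨?_, IsSelfAdjoint.mul_star_self _⟩
    rw [IsIdempotentElem, mul_assoc, ← mul_assoc (star _), h1, ← mul_assoc, h2]
  have h3 : q.1 i * (z.1 i * r i hi * star (z.1 i * r i hi))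
      = z.1 i * r i hi * star (z.1 i * r i hi) := by
    rw [← mul_assoc, ← mul_assoc, hqz]
  have h4 := hproj.sub_of_mul_eq_right (hq i) h3
  have hval : (q - z * R * star (z * R)).1 i - (0 : boundedFamilies B).1 i
      = q.1 i - z.1 i * r i hi * star (z.1 i * r i hi) := by
    rw [← hvi]; exact sub_zero _
  rw [hval] at hi2
  rw [hvi]
  exact ⟨h1, (sub_eq_zero.mp (h4.eq_zero_of_norm_lt_one hi2)).symm, h2⟩

end Lifts

/-! ### Morphisms built from matrix units. -/

section MatrixUnits

variable {F : Type*} [Ring F] [StarRing F] [Algebra ℂ F] [FiniteDimensional ℂ F]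
  {G : Type*} [Ring G] [StarRing G] [Algebra ℂ G] [StarModule ℂ G]

/-- The `v e a` play the role of one column of matrix units, and `v e a * star (v e b)` that of the
full system. -/
theorem exists_starAlgHom_of_partialIsometries (v : ∀ e : MinProj F, Fin (blockRep e).1 → G)
    (hself : ∀ e a, v e a * star (v e a) * v e a = v e a)
    (hsame : ∀ e a b, star (v e a) * v e a = star (v e b) * v e b)
    (horth : ∀ e a b, a ≠ b → star (v e a) * v e b = 0)
    (horth' : ∀ e f a b, e ≠ f → star (v e a) * v f b = 0)
    (hsum : ∑ e, ∑ a, v e a * star (v e a) = 1) :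
    ∃ Φ : F →⋆ₐ[ℂ] G,
      ∀ x, Φ x = ∑ e, ∑ a, ∑ b, (blockRep e).2 x a b • (v e a * star (v e b)) := by
  have hkey : ∀ x e c, (∑ e, ∑ a, ∑ b, (blockRep e).2 x a b • (v e a * star (v e b))) * v e c
      = ∑ a, (blockRep e).2 x a c • v e a := by
    intro x e c
    rw [Finset.sum_mul, Finset.sum_eq_single e, Finset.sum_mul]
    · refine Finset.sum_congr rfl fun a _ => ?_
      rw [Finset.sum_mul, Finset.sum_eq_single c]
      · rw [smul_mul_assoc, mul_assoc, hsame e c a, ← mul_assoc, hself]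
      · intro b _ hb
        rw [smul_mul_assoc, mul_assoc, horth e b c hb, mul_zero, smul_zero]
      · simp
    · intro f _ hf
      rw [Finset.sum_mul]
      refine Finset.sum_eq_zero fun a _ => ?_
      rw [Finset.sum_mul]
      refine Finset.sum_eq_zero fun b _ => ?_
      rw [smul_mul_assoc, mul_assoc, horth' f e b c hf, mul_zero, smul_zero]
    · simp
  have hone : ∑ e : MinProj F, ∑ a, ∑ b, (blockRep e).2 1 a b • (v e a * star (v e b)) = 1 := by
    rw [← hsum]
    refine Finset.sum_congr rfl fun e _ => Finset.sum_congr rfl fun a _ => ?_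
    rw [Finset.sum_eq_single a]
    · rw [map_one, Matrix.one_apply_eq, one_smul]
    · intro b _ hb
      rw [map_one, Matrix.one_apply_ne hb.symm, zero_smul]
    · simp
  refine ⟨
    { toFun := fun x => ∑ e, ∑ a, ∑ b, (blockRep e).2 x a b • (v e a * star (v e b))
      map_one' := hone
      map_mul' := fun x y => ?_
      map_zero' := by simp
      map_add' := fun x y => by
        simp only [map_add, Matrix.add_apply, add_smul, Finset.sum_add_distrib]
      commutes' := fun c => by
        simp only [Algebra.algebraMap_eq_smul_one, map_smul, Matrix.smul_apply, smul_assoc,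
          ← Finset.smul_sum, hone]
      map_star' := fun x => ?_ }, fun x => rfl⟩
  · conv_rhs => rw [Finset.mul_sum]
    refine Finset.sum_congr rfl fun e _ => ?_
    have h1 : ∀ a b, (∑ e, ∑ a, ∑ b, (blockRep e).2 x a b • (v e a * star (v e b))) *
        ((blockRep e).2 y a b • (v e a * star (v e b)))
        = ∑ c, ((blockRep e).2 x c a * (blockRep e).2 y a b) • (v e c * star (v e b)) := by
      intro a b
      rw [mul_smul_comm, ← mul_assoc, hkey, Finset.sum_mul, Finset.smul_sum]
      refine Finset.sum_congr rfl fun c _ => ?_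
      rw [smul_mul_assoc, smul_smul, mul_comm]
    have h2 : ∀ a, (∑ e, ∑ a, ∑ b, (blockRep e).2 x a b • (v e a * star (v e b))) *
        (∑ b, (blockRep e).2 y a b • (v e a * star (v e b)))
        = ∑ b, ∑ c, ((blockRep e).2 x c a * (blockRep e).2 y a b) • (v e c * star (v e b)) := by
      intro a
      rw [Finset.mul_sum]
      exact Finset.sum_congr rfl fun b _ => h1 a b
    rw [Finset.mul_sum, Finset.sum_congr rfl fun a _ => h2 a]
    simp only [map_mul, Matrix.mul_apply, Finset.sum_smul]
    refine (Finset.sum_congr rfl fun a _ => Finset.sum_comm).trans (Finset.sum_comm.trans ?_)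
    exact Finset.sum_congr rfl fun c _ => Finset.sum_comm
  · simp only [star_sum, star_smul, star_mul, star_star]
    refine Finset.sum_congr rfl fun e _ => ?_
    rw [Finset.sum_comm]
    refine Finset.sum_congr rfl fun a _ => Finset.sum_congr rfl fun b _ => ?_
    rw [map_star, Matrix.star_apply]

end MatrixUnits

/-! ### Weak stability of morphisms and rigidity of multiplicities. -/

section Stability

variable {F : Type*} [Ring F] [StarRing F] [Algebra ℂ F] [FiniteDimensional ℂ F]
variable {I : Type*} {U : Ultrafilter I} {B : I → Type*} [∀ i, CStarAlgebra (B i)]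

/-- Lift the diagonal matrix units to orthogonal projections, then one column of each block to
partial isometries between them. The lifted projections sum to a projection close to `1`, hence
equal to `1`, at almost all indices. -/
theorem exists_local_lift [∀ i, FiniteDimensional ℂ (B i)] (hF : HasBlocks F)
    (φ : F →⋆ₐ[ℂ] Ultraproduct U B) :
    ∃ Y : F → boundedFamilies B, (∀ x, Ultraproduct.mk U B (Y x) = φ x) ∧
      ∀ᶠ i in (U : Filter I), ∃ Φ : F →⋆ₐ[ℂ] B i, ∀ x, Φ x = (Y x).1 i := by
  classical
  let o : ∀ e : MinProj F, Fin (blockRep e).1 := fun e => ⟨0, hF.dimVec_pos e⟩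
  have hEproj : ∀ (e : MinProj F) a, IsStarProjection (hF.matUnit e a a) := fun e a =>
    ⟨hF.matUnit_mul_matUnit e a a a, hF.star_matUnit e a a⟩
  obtain ⟨p, hp1, hp2, hp3⟩ := exists_lift_projections (U := U) (B := B) Finset.univ
    (fun j : Σ e : MinProj F, Fin (blockRep e).1 => φ (hF.matUnit j.1 j.2 j.2))
    (fun j => (hEproj j.1 j.2).map φ) (by
      rintro ⟨e, a⟩ ⟨f, b⟩ hne
      rw [← map_mul]
      by_cases hef : e = f
      · subst hef
        rw [hF.matUnit_mul_matUnit_of_ne e (by rintro rfl; exact hne rfl), map_zero]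
      · rw [hF.matUnit_mul_matUnit_of_ne' hef, map_zero])
  simp only [Finset.mem_univ, forall_const] at hp1 hp2 hp3
  have hv := fun (e : MinProj F) (a : Fin (blockRep e).1) =>
    exists_lift_partialIsometry (U := U) (V := φ (hF.matUnit e a (o e))) (hp2 ⟨e, o e⟩)
      (hp2 ⟨e, a⟩)
      (by rw [← map_star, ← map_mul, hF.star_matUnit, hF.matUnit_mul_matUnit, hp1])
      (by rw [← map_star, ← map_mul, hF.star_matUnit, hF.matUnit_mul_matUnit, hp1])
      (by rw [hp1, ← map_mul, hF.matUnit_mul_matUnit])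
  choose v hv1 hv2 using hv
  have hsum : Ultraproduct.mk U B (∑ e, ∑ a, p ⟨e, a⟩) = Ultraproduct.mk U B 1 := by
    simp only [map_sum, hp1]
    rw [map_one, ← map_one φ, ← hF.sum_matUnit]
    simp only [map_sum]
  refine ⟨fun x => ∑ e, ∑ a, ∑ b, (blockRep e).2 x a b • (v e a * star (v e b)), fun x => ?_, ?_⟩
  · conv_rhs => rw [hF.eq_sum_matUnit x]
    simp only [map_sum, map_smul, map_mul, ← Ultraproduct.star_mk, hv1]
    simp only [← map_star, ← map_mul, hF.star_matUnit, hF.matUnit_mul_matUnit]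
  have hv3 : ∀ᶠ i in (U : Filter I), ∀ e a, star ((v e a).1 i) * (v e a).1 i = (p ⟨e, o e⟩).1 i ∧
      (v e a).1 i * star ((v e a).1 i) = (p ⟨e, a⟩).1 i ∧
        (v e a).1 i * (p ⟨e, o e⟩).1 i = (v e a).1 i :=
    eventually_all.mpr fun e => eventually_all.mpr fun a => hv2 e a
  filter_upwards [hv3, eventually_norm_sub_lt hsum one_pos] with i hi hi1
  have hval : ∀ g : (Σ e : MinProj F, Fin (blockRep e).1) → boundedFamilies B,
      (∑ e, ∑ a, g ⟨e, a⟩ : boundedFamilies B).1 i = ∑ e, ∑ a, (g ⟨e, a⟩).1 i := by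
    intro g
    simp only [AddSubmonoidClass.coe_finsetSum, Finset.sum_apply]
  rw [hval] at hi1
  have hpsum : ∑ e, ∑ a, (p ⟨e, a⟩).1 i = 1 := by
    rw [← Fintype.sum_sigma (fun j => (p j).1 i)] at hi1 ⊢
    have hproj : IsStarProjection (∑ j, (p j).1 i) := by
      refine ⟨?_, isSelfAdjoint_sum _ fun j _ => (hp2 j i).isSelfAdjoint⟩
      rw [IsIdempotentElem, Finset.sum_mul]
      refine Finset.sum_congr rfl fun j _ => ?_
      rw [Finset.mul_sum, Finset.sum_eq_single j]
      · exact (hp2 j i).isIdempotentElem.eq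
      · intro k _ hk
        exact hp3 j k hk.symm i
      · simp
    rw [norm_sub_rev] at hi1
    exact (sub_eq_zero.mp (hproj.one_sub.eq_zero_of_norm_lt_one hi1)).symm
  have hvp : ∀ e a, star ((v e a).1 i) * (p ⟨e, a⟩).1 i = star ((v e a).1 i) := fun e a => by
    rw [← (hi e a).2.1, ← mul_assoc, (hi e a).1, (hi e (o e)).1.symm, (hi e (o e)).1]
    have := congrArg star (hi e a).2.2
    rwa [star_mul, (hp2 _ i).isSelfAdjoint.star_eq] at this
  have hpv : ∀ e a, (p ⟨e, a⟩).1 i * (v e a).1 i = (v e a).1 i := fun e a => by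
    rw [← (hi e a).2.1, mul_assoc, (hi e a).1, (hi e a).2.2]
  have horth : ∀ j k : (Σ e : MinProj F, Fin (blockRep e).1), j ≠ k →
      star ((v j.1 j.2).1 i) * (v k.1 k.2).1 i = 0 := by
    intro j k hjk
    rw [← hvp, ← hpv k.1 k.2, mul_assoc, ← mul_assoc _ _ ((v k.1 k.2).1 i), hp3 _ _ hjk, zero_mul,
      mul_zero]
  obtain ⟨Φ, hΦ⟩ := exists_starAlgHom_of_partialIsometries (fun e a => (v e a).1 i)
    (fun e a => by rw [mul_assoc, (hi e a).1, (hi e a).2.2])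
    (fun e a b => by rw [(hi e a).1, (hi e b).1])
    (fun e a b hab => horth ⟨e, a⟩ ⟨e, b⟩ (by simpa using hab))
    (fun e f a b hef => horth ⟨e, a⟩ ⟨f, b⟩ (by simp [hef]))
    (by simpa only [fun e a => (hi e a).2.1] using hpsum)
  refine ⟨Φ, fun x => ?_⟩
  rw [hΦ]
  simp only [AddSubmonoidClass.coe_finsetSum, Finset.sum_apply]
  rfl

/-- The sum `∑ Φ(E_{ao}) s Ψ(E_{oa})` intertwines `Φ` and `Ψ` exactly for any `s`. Its class is the
original `s`, which already intertwines `φ` and `ψ`, so it is invertible at almost all indices. -/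
theorem eventually_mappingMatrix_eq (hF : HasBlocks F) {φ ψ : F →⋆ₐ[ℂ] Ultraproduct U B}
    {s : Ultraproduct U B} (hs : IsUnit s) (hφψ : ∀ x, φ x * s = s * ψ x)
    {Y Z : F → boundedFamilies B} (hY : ∀ x, Ultraproduct.mk U B (Y x) = φ x)
    (hZ : ∀ x, Ultraproduct.mk U B (Z x) = ψ x) :
    ∀ᶠ i in (U : Filter I), ∀ Φ Ψ : F →⋆ₐ[ℂ] B i,
      (∀ e a b, Φ (hF.matUnit e a b) = (Y (hF.matUnit e a b)).1 i) →
      (∀ e a b, Ψ (hF.matUnit e a b) = (Z (hF.matUnit e a b)).1 i) →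
      mappingMatrix Φ = mappingMatrix Ψ := by
  let o : ∀ e : MinProj F, Fin (blockRep e).1 := fun e => ⟨0, hF.dimVec_pos e⟩
  obtain ⟨⟨s, t, hst, hts⟩, rfl⟩ := hs
  obtain ⟨s, rfl⟩ := Ultraproduct.mk_surjective U B s
  obtain ⟨t, rfl⟩ := Ultraproduct.mk_surjective U B t
  simp only at hφψ
  let S : boundedFamilies B :=
    ∑ e, ∑ a, Y (hF.matUnit e a (o e)) * s * Z (hF.matUnit e (o e) a)
  have hS : Ultraproduct.mk U B S = Ultraproduct.mk U B s := by
    simp only [S, map_sum, map_mul, hY, hZ]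
    simp only [mul_assoc, ← hφψ]
    simp only [← mul_assoc, ← map_mul, hF.matUnit_mul_matUnit]
    simp only [← Finset.sum_mul, ← map_sum, hF.sum_matUnit, map_one, one_mul]
  filter_upwards [eventually_isUnit (x := S) (y := t) (hS ▸ hst) (hS ▸ hts)] with i hi Φ Ψ hΦ hΨ
  refine mappingMatrix_eq_of_intertwiner hi fun x => ?_
  have hSi : S.1 i = ∑ e, ∑ a, Φ (hF.matUnit e a (o e)) * s.1 i * Ψ (hF.matUnit e (o e) a) := by
    simp only [S, AddSubmonoidClass.coe_finsetSum, Finset.sum_apply, hΦ, hΨ]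
    rfl
  rw [hSi]
  simp only [Finset.mul_sum, Finset.sum_mul]
  refine Finset.sum_congr rfl fun e _ => ?_
  have h1 : ∀ a, Φ x * (Φ (hF.matUnit e a (o e)) * s.1 i * Ψ (hF.matUnit e (o e) a))
      = ∑ c, (blockRep e).2 x c a •
        (Φ (hF.matUnit e c (o e)) * s.1 i * Ψ (hF.matUnit e (o e) a)) := by
    intro a
    rw [← mul_assoc, ← mul_assoc, ← map_mul, hF.mul_matUnit, map_sum, Finset.sum_mul,
      Finset.sum_mul]
    simp only [map_smul, smul_mul_assoc]
  have h2 : ∀ a, Φ (hF.matUnit e a (o e)) * s.1 i * Ψ (hF.matUnit e (o e) a) * Ψ x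
      = ∑ c, (blockRep e).2 x a c •
        (Φ (hF.matUnit e a (o e)) * s.1 i * Ψ (hF.matUnit e (o e) c)) := by
    intro a
    rw [mul_assoc, ← map_mul, hF.matUnit_mul, map_sum, Finset.mul_sum]
    simp only [map_smul, mul_smul_comm]
  simp only [h1, h2]
  exact Finset.sum_comm

/-- Contractivity expressed through representatives: write `‖x‖² - star x * x = star y * y` and lift
this identity, which bounds `star X * X` by `‖x‖² + ε²` at almost all indices. -/
theorem eventually_norm_le {A : Type*} [CStarAlgebra A] (φ : A →⋆ₐ[ℂ] Ultraproduct U B) {x : A}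
    {X : boundedFamilies B} (hX : Ultraproduct.mk U B X = φ x) {ε : ℝ} (hε : 0 < ε) :
    ∀ᶠ i in (U : Filter I), ‖X.1 i‖ ≤ ‖x‖ + ε := by
  obtain ⟨y, hy⟩ : ∃ y : A, algebraMap ℝ A (‖x‖ ^ 2) - star x * x = star y * y := by
    let := CStarAlgebra.spectralOrder A
    have := CStarAlgebra.spectralOrderedRing A
    have h : star x * x ≤ algebraMap ℝ A (‖x‖ ^ 2) := CStarAlgebra.star_mul_le_algebraMap_norm_sq
    exact CStarAlgebra.nonneg_iff_eq_star_mul_self.mp (sub_nonneg.mpr h)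
  obtain ⟨Y, hY⟩ := Ultraproduct.mk_surjective U B (φ y)
  have h1 : Ultraproduct.mk U B (star X * X + star Y * Y)
      = Ultraproduct.mk U B (algebraMap ℂ _ ((‖x‖ ^ 2 : ℝ) : ℂ)) := by
    rw [map_add, map_mul, map_mul, ← Ultraproduct.star_mk, ← Ultraproduct.star_mk, hX, hY,
      ← map_star, ← map_star, ← map_mul, ← map_mul, ← map_add, ← hy, add_sub_cancel,
      AlgHomClass.commutes (Ultraproduct.mk U B)]
    exact AlgHomClass.commutes φ ((‖x‖ ^ 2 : ℝ) : ℂ)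
  filter_upwards [eventually_norm_sub_lt h1 (pow_pos hε 2)] with i hi
  let := CStarAlgebra.spectralOrder (B i)
  have := CStarAlgebra.spectralOrderedRing (B i)
  set d := (star X * X + star Y * Y : boundedFamilies B).1 i
    - (algebraMap ℂ (boundedFamilies B) ((‖x‖ ^ 2 : ℝ) : ℂ)).1 i with hd
  have hd' : star (X.1 i) * X.1 i + star (Y.1 i) * Y.1 i - algebraMap ℝ (B i) (‖x‖ ^ 2) = d := rfl
  have hds : IsSelfAdjoint d := by
    rw [← hd']
    exact ((IsSelfAdjoint.star_mul_self _).add (IsSelfAdjoint.star_mul_self _)).sub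
      (IsSelfAdjoint.algebraMap _ (IsSelfAdjoint.all _))
  have h2 : star (X.1 i) * X.1 i ≤ algebraMap ℝ (B i) (‖x‖ ^ 2 + ε ^ 2) := by
    calc star (X.1 i) * X.1 i ≤ star (X.1 i) * X.1 i + star (Y.1 i) * Y.1 i :=
          le_add_of_nonneg_right (star_mul_self_nonneg _)
      _ = algebraMap ℝ (B i) (‖x‖ ^ 2) + d := by rw [← hd']; abel
      _ ≤ algebraMap ℝ (B i) (‖x‖ ^ 2) + algebraMap ℝ (B i) (ε ^ 2) := by
        gcongr
        exact hds.le_algebraMap_norm_self.trans (algebraMap_mono _ hi.le)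
      _ = _ := by rw [map_add]
  have h3 : ‖star (X.1 i) * X.1 i‖ ≤ ‖x‖ ^ 2 + ε ^ 2 :=
    (CStarAlgebra.norm_le_iff_le_algebraMap _ (by positivity) (star_mul_self_nonneg _)).mpr h2
  rw [CStarRing.norm_star_mul_self] at h3
  nlinarith [norm_nonneg x, norm_nonneg (X.1 i)]

end Stability

/-! ### Diagonalisation along a countably incomplete ultrafilter. -/

section Diagonal

variable {I : Type*} {U : Ultrafilter I}

/-- The sets `V n` decrease, belong to `U` and have empty intersection, so almost every `i` has a
last `n` with `i ∈ V n`; this is `κ i`. -/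
theorem exists_diagonal (hU : ∃ S : ℕ → Set I, (∀ n, S n ∈ U) ∧ ⋂ n, S n = ∅)
    (T : ℕ → Set I) (hT : ∀ k, T k ∈ U) :
    ∃ κ : I → ℕ, {i | i ∈ T (κ i)} ∈ U ∧ ∀ j, ∀ᶠ i in (U : Filter I), j ≤ κ i := by
  classical
  obtain ⟨S, hS, hempty⟩ := hU
  let V : ℕ → Set I := fun n => ⋂ m ∈ Set.Iic n, S m ∩ T m
  have hV : ∀ n, V n ∈ (U : Filter I) := fun n =>
    (Filter.biInter_mem (Set.finite_Iic n)).mpr fun m _ => Filter.inter_mem (hS m) (hT m)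
  have hmem : ∀ i n, i ∈ V n ↔ ∀ m ≤ n, i ∈ S m ∧ i ∈ T m := by
    intro i n
    simp [V]
  have hex : ∀ i, ∃ n, i ∉ V n := by
    intro i
    by_contra! h
    have : i ∈ ⋂ n, S n := by
      rw [Set.mem_iInter]
      exact fun n => ((hmem i n).mp (h n) n le_rfl).1
    rw [hempty] at this
    exact this
  have hlt : ∀ i j, i ∈ V j → j < Nat.find (hex i) := by
    intro i j hij
    by_contra! h
    refine Nat.find_spec (hex i) ?_
    rw [hmem] at hij ⊢
    exact fun m hm => hij m (le_trans hm h)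
  -- `Nat.find` is the first `n` with `i ∉ V n`. The truncated subtraction matters only off `V 0`,
  -- which is negligible.
  refine ⟨fun i => Nat.find (hex i) - 1, ?_, fun j => ?_⟩
  · filter_upwards [hV 0] with i hi
    have h1 := hlt i 0 hi
    have h2 : i ∈ V (Nat.find (hex i) - 1) := by
      by_contra h
      have := Nat.find_min' (hex i) h
      omega
    exact ((hmem i _).mp h2 _ le_rfl).2
  · filter_upwards [hV j] with i hi
    have := hlt i j hi
    omega

end Diagonal

/-! ### Liftings, their matrix sequences, and the three diagonal arguments. -/

section Main

universe u v w

variable {A : Type u} [CStarAlgebra A] {𝒜 : ℕ → StarSubalgebra ℂ A}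
  {I : Type v} {U : Ultrafilter I} {B : I → Type w} [∀ i, CStarAlgebra (B i)]

theorem norm_starAlgHom_apply_le {S : StarSubalgebra ℂ A} [FiniteDimensional ℂ S]
    {G : Type*} [CStarAlgebra G] (Φ : S →⋆ₐ[ℂ] G) (x : S) : ‖Φ x‖ ≤ ‖(x : A)‖ := by
  have : IsClosed (S : Set A) := (Subalgebra.toSubmodule S.toSubalgebra).closed_of_finiteDimensional
  exact NonUnitalStarAlgHom.norm_apply_le Φ x

open Classical in
/-- The extension by zero of a family of morphisms defined on subalgebras. -/
def extendZero {κ : I → ℕ} {s : Set I} (Φ : ∀ i ∈ s, 𝒜 (κ i) →⋆ₐ[ℂ] B i) (i : I) (x : A) : B i :=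
  if h : i ∈ s ∧ x ∈ 𝒜 (κ i) then Φ i h.1 ⟨x, h.2⟩ else 0

theorem extendZero_apply {κ : I → ℕ} {s : Set I}
    (Φ : ∀ i ∈ s, 𝒜 (κ i) →⋆ₐ[ℂ] B i) {i : I} {x : A} (hi : i ∈ s) (hx : x ∈ 𝒜 (κ i)) :
    extendZero Φ i x = Φ i hi ⟨x, hx⟩ := dif_pos ⟨hi, hx⟩

theorem norm_extendZero_le [∀ k, FiniteDimensional ℂ (𝒜 k)] {κ : I → ℕ} {s : Set I}
    (Φ : ∀ i ∈ s, 𝒜 (κ i) →⋆ₐ[ℂ] B i) (i : I) (x : A) : ‖extendZero Φ i x‖ ≤ ‖x‖ := by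
  by_cases h : i ∈ s ∧ x ∈ 𝒜 (κ i)
  · rw [extendZero_apply Φ h.1 h.2]
    exact norm_starAlgHom_apply_le _ _
  · rw [extendZero, dif_neg h, norm_zero]
    exact norm_nonneg _

/-- The family of values at `x` of a family of morphisms defined on subalgebras. -/
def valueFamily [∀ k, FiniteDimensional ℂ (𝒜 k)] {κ : I → ℕ} {s : Set I}
    (Φ : ∀ i ∈ s, 𝒜 (κ i) →⋆ₐ[ℂ] B i) (x : A) : boundedFamilies B :=
  ⟨fun i => extendZero Φ i x, ‖x‖, fun i => norm_extendZero_le Φ i x⟩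

/-- The lifting given by morphisms defined on the `𝒜 (κ i)`, where `κ` tends to infinity. -/
def Lifting.ofDiagonal [∀ k, FiniteDimensional ℂ (𝒜 k)] (h𝒜 : Monotone 𝒜)
    (φ : A →⋆ₐ[ℂ] Ultraproduct U B) {κ : I → ℕ} (hκ : ∀ j, ∀ᶠ i in (U : Filter I), j ≤ κ i)
    {s : Set I} (hs : s ∈ U) (Φ : ∀ i ∈ s, 𝒜 (κ i) →⋆ₐ[ℂ] B i)
    (h : ∀ j, ∀ x ∈ 𝒜 j, Ultraproduct.mk U B (valueFamily Φ x) = φ x) : Lifting 𝒜 φ where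
  support := s
  support_mem := hs
  alg i := 𝒜 (κ i)
  finiteDimensional i _ := inferInstance
  le_alg k := (hκ k).mono fun _ hi => h𝒜 hi
  hom := Φ
  lifts k x hx := ⟨valueFamily Φ x, (h k x hx).symm, by
    filter_upwards [hκ k, hs] with i hi his
    exact ⟨his, h𝒜 hi hx, (extendZero_apply Φ his (h𝒜 hi hx)).symm⟩⟩

namespace Lifting

variable {φ ψ : A →⋆ₐ[ℂ] Ultraproduct U B}

theorem eventually_mem (Φ : Lifting 𝒜 φ) (k : ℕ) :
    ∀ᶠ i in (U : Filter I), i ∈ Φ.support ∧ 𝒜 k ≤ Φ.alg i :=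
  (Filter.eventually_mem_set.mpr Φ.support_mem).and (Φ.le_alg k)

/-- The restriction of a lifting to `𝒜 k`. -/
def restrict (Φ : Lifting 𝒜 φ) {k : ℕ} {i : I} (h : i ∈ Φ.support ∧ 𝒜 k ≤ Φ.alg i) :
    𝒜 k →⋆ₐ[ℂ] B i :=
  (Φ.hom i h.1).comp (StarSubalgebra.inclusion h.2)

theorem matrixSeq_eq_mk (Φ : Lifting 𝒜 φ) {k : ℕ}
    {M : ∀ i, Matrix (MinProj (B i)) (MinProj (𝒜 k)) ℕ}
    (h : ∀ᶠ i in (U : Filter I), ∃ hi : i ∈ Φ.support ∧ 𝒜 k ≤ Φ.alg i,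
      mappingMatrix (Φ.restrict hi) = M i) : Φ.matrixSeq k = internalMk U M := by
  refine Quotient.sound' ?_
  filter_upwards [h] with i hi
  obtain ⟨hi, h1⟩ := hi
  exact (dif_pos hi).trans h1

theorem eventually_matrixSeq (Φ : Lifting 𝒜 φ) {k : ℕ}
    {M : ∀ i, Matrix (MinProj (B i)) (MinProj (𝒜 k)) ℕ} (h : Φ.matrixSeq k = internalMk U M) :
    ∀ᶠ i in (U : Filter I), ∃ hi : i ∈ Φ.support ∧ 𝒜 k ≤ Φ.alg i,
      mappingMatrix (Φ.restrict hi) = M i := by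
  have h1 := Quotient.exact' h
  filter_upwards [h1, Φ.eventually_mem k] with i hi hi'
  exact ⟨hi', (dif_pos hi').symm.trans hi⟩

/-- A representing family for the mapping matrices of a lifting. -/
theorem exists_matrixSeq_eq_mk (Φ : Lifting 𝒜 φ) (k : ℕ) :
    ∃ M : ∀ i, Matrix (MinProj (B i)) (MinProj (𝒜 k)) ℕ, Φ.matrixSeq k = internalMk U M :=
  ⟨_, rfl⟩

theorem eventually_restrict_eq (Φ : Lifting 𝒜 φ) {k : ℕ} (x : 𝒜 k) :
    ∃ y : boundedFamilies B, Ultraproduct.mk U B y = φ x ∧ ∀ᶠ i in (U : Filter I),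
      ∀ hi : i ∈ Φ.support ∧ 𝒜 k ≤ Φ.alg i, Φ.restrict hi x = y.1 i := by
  obtain ⟨y, hy, h⟩ := Φ.lifts k x x.2
  refine ⟨y, hy.symm, ?_⟩
  filter_upwards [h] with i hi hi'
  obtain ⟨h1, h2, h3⟩ := hi
  exact h3

/-- With `φ = ψ` this is independence of the lifting. The intertwiner supplied to the rigidity lemma
is `star u`. -/
theorem matrixSeq_eq_of_innerConj [∀ k, FiniteDimensional ℂ (𝒜 k)] (h : InnerConj φ ψ)
    (Φ : Lifting 𝒜 φ) (Ψ : Lifting 𝒜 ψ) : Φ.matrixSeq = Ψ.matrixSeq := by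
  funext k
  obtain ⟨u, hu, hφψ⟩ := h
  have hu1 : u * star u = 1 := Unitary.mul_star_self_of_mem hu
  have hu2 : star u * u = 1 := Unitary.star_mul_self_of_mem hu
  have hF := hasBlocks_starSubalgebra (𝒜 k)
  choose Y hY1 hY2 using fun x : 𝒜 k => Φ.eventually_restrict_eq x
  choose Z hZ1 hZ2 using fun x : 𝒜 k => Ψ.eventually_restrict_eq x
  have key := eventually_mappingMatrix_eq hF (φ := φ.comp (𝒜 k).subtype)
    (ψ := ψ.comp (𝒜 k).subtype) (s := star u) ⟨⟨star u, u, hu2, hu1⟩, rfl⟩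
    (fun x => by
      simp only [StarAlgHom.comp_apply]
      rw [hφψ, mul_assoc, hu1, mul_one]) hY1 hZ1
  have hY3 : ∀ᶠ i in (U : Filter I), ∀ e a b, ∀ hi : i ∈ Φ.support ∧ 𝒜 k ≤ Φ.alg i,
      Φ.restrict hi (hF.matUnit e a b) = (Y (hF.matUnit e a b)).1 i :=
    eventually_all.mpr fun e => eventually_all.mpr fun a => eventually_all.mpr fun b => hY2 _
  have hZ3 : ∀ᶠ i in (U : Filter I), ∀ e a b, ∀ hi : i ∈ Ψ.support ∧ 𝒜 k ≤ Ψ.alg i,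
      Ψ.restrict hi (hF.matUnit e a b) = (Z (hF.matUnit e a b)).1 i :=
    eventually_all.mpr fun e => eventually_all.mpr fun a => eventually_all.mpr fun b => hZ2 _
  obtain ⟨M, hM⟩ := Ψ.exists_matrixSeq_eq_mk k
  rw [hM]
  refine Φ.matrixSeq_eq_mk ?_
  filter_upwards [key, hY3, hZ3, Φ.eventually_mem k, Ψ.eventually_matrixSeq hM]
    with i h1 h2 h3 h4 h5
  obtain ⟨h5, h6⟩ := h5
  exact ⟨h4, (h1 _ _ (fun e a b => h2 e a b h4) (fun e a b => h3 e a b h5)).trans h6⟩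

theorem isCompatible [∀ k, FiniteDimensional ℂ (𝒜 k)] [∀ i, FiniteDimensional ℂ (B i)]
    (h𝒜 : Monotone 𝒜) (Φ : Lifting 𝒜 φ) : IsCompatible 𝒜 h𝒜 Φ.matrixSeq where
  isMappingMatrix k := by
    obtain ⟨M, hM⟩ := Φ.exists_matrixSeq_eq_mk k
    rw [hM]
    change ∀ᶠ i in (U : Filter I), IsMappingMatrix (M i)
    filter_upwards [Φ.eventually_matrixSeq hM] with i hi
    obtain ⟨hi, h⟩ := hi
    rw [← h]
    exact isMappingMatrix_mappingMatrix (hasBlocks_starSubalgebra _) (hasBlocks _) _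
  mul_dim k := by
    obtain ⟨M, hM⟩ := Φ.exists_matrixSeq_eq_mk k
    rw [hM]
    refine Quotient.sound' ?_
    filter_upwards [Φ.eventually_matrixSeq hM] with i hi
    obtain ⟨hi, h⟩ := hi
    rw [← h]
    exact mappingMatrix_mulVec (hasBlocks_starSubalgebra _) _
  mul_inclusion k := by
    obtain ⟨M, hM⟩ := Φ.exists_matrixSeq_eq_mk k
    obtain ⟨N, hN⟩ := Φ.exists_matrixSeq_eq_mk (k + 1)
    rw [hM, hN]
    refine Quotient.sound' ?_
    filter_upwards [Φ.eventually_matrixSeq hM, Φ.eventually_matrixSeq hN] with i hi hi'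
    obtain ⟨hi, h⟩ := hi
    obtain ⟨hi', h'⟩ := hi'
    rw [← h, ← h', ← mappingMatrix_comp (hasBlocks_starSubalgebra _) (hasBlocks_starSubalgebra _)]
    rfl

end Lifting

/-- For `z` in the union close to `x`, `φ x - ψ x = φ (x - z) - ψ (x - z)`, and both terms have
representatives that are small at almost all indices. -/
theorem starAlgHom_eq_of_eqOn_dense (hdense : Dense (⋃ k, (𝒜 k : Set A)))
    {φ ψ : A →⋆ₐ[ℂ] Ultraproduct U B} (h : ∀ k, ∀ x ∈ 𝒜 k, φ x = ψ x) : φ = ψ := by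
  ext1 x
  obtain ⟨X, hX⟩ := Ultraproduct.mk_surjective U B (φ x)
  obtain ⟨Y, hY⟩ := Ultraproduct.mk_surjective U B (ψ x)
  rw [← hX, ← hY, Ultraproduct.mk_eq_mk, Metric.tendsto_nhds]
  intro ε hε
  obtain ⟨z, hz, hxz⟩ := Metric.mem_closure_iff.mp (hdense x) (ε / 8) (by positivity)
  obtain ⟨k, hk⟩ := Set.mem_iUnion.mp hz
  obtain ⟨V, hV⟩ := Ultraproduct.mk_surjective U B (φ (x - z))
  obtain ⟨W, hW⟩ := Ultraproduct.mk_surjective U B (ψ (x - z))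
  have h1 : Ultraproduct.mk U B (X - Y) = Ultraproduct.mk U B (V - W) := by
    rw [map_sub, map_sub, hX, hY, hV, hW, map_sub, map_sub, h k z hk]
    abel
  rw [dist_eq_norm] at hxz
  filter_upwards [eventually_norm_sub_lt h1 (ε := ε / 8) (by positivity),
    eventually_norm_le φ hV (ε := ε / 8) (by positivity),
    eventually_norm_le ψ hW (ε := ε / 8) (by positivity)] with i hi1 hi2 hi3
  have h2 : X.1 i - Y.1 i = ((X - Y).1 i - (V - W).1 i) + (V.1 i - W.1 i) := by
    change X.1 i - Y.1 i = ((X.1 i - Y.1 i) - (V.1 i - W.1 i)) + (V.1 i - W.1 i)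
    abel
  rw [Real.dist_eq, sub_zero, abs_norm, h2]
  have h3 := norm_add_le ((X - Y).1 i - (V - W).1 i) (V.1 i - W.1 i)
  have h4 := norm_sub_le (V.1 i) (W.1 i)
  linarith

/-- At almost every `i` the two liftings have equal matrices on `𝒜 (κ i)` and are conjugate there by
some `u i`. Each `𝒜 k` is eventually inside `𝒜 (κ i)`, so the class of `u` conjugates on the union,
and by density everywhere. -/
theorem innerConj_of_matrixSeq_eq [∀ k, FiniteDimensional ℂ (𝒜 k)]
    [∀ i, FiniteDimensional ℂ (B i)] (h𝒜 : Monotone 𝒜)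
    (hdense : Dense (⋃ k, (𝒜 k : Set A)))
    (hU : ∃ S : ℕ → Set I, (∀ n, S n ∈ U) ∧ ⋂ n, S n = ∅) {φ ψ : A →⋆ₐ[ℂ] Ultraproduct U B}
    (Φ : Lifting 𝒜 φ) (Ψ : Lifting 𝒜 ψ) (h : Φ.matrixSeq = Ψ.matrixSeq) : InnerConj φ ψ := by
  classical
  let T : ℕ → Set I := fun k => {i | ∃ (hi : i ∈ Φ.support ∧ 𝒜 k ≤ Φ.alg i)
    (hi' : i ∈ Ψ.support ∧ 𝒜 k ≤ Ψ.alg i),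
    mappingMatrix (Φ.restrict hi) = mappingMatrix (Ψ.restrict hi')}
  have hT : ∀ k, T k ∈ U := by
    intro k
    obtain ⟨M, hM⟩ := Ψ.exists_matrixSeq_eq_mk k
    filter_upwards [Φ.eventually_matrixSeq ((congrFun h k).trans hM),
      Ψ.eventually_matrixSeq hM] with i hi hi'
    obtain ⟨hi, h1⟩ := hi
    obtain ⟨hi', h2⟩ := hi'
    exact ⟨hi, hi', h1.trans h2.symm⟩
  obtain ⟨κ, hκ1, hκ2⟩ := exists_diagonal hU T hT
  have hex : ∀ i, ∃ u ∈ unitary (B i), i ∈ T (κ i) → ∀ x ∈ 𝒜 (κ i),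
      ∀ (h1 : i ∈ Φ.support) (h2 : x ∈ Φ.alg i) (h3 : i ∈ Ψ.support) (h4 : x ∈ Ψ.alg i),
      Φ.hom i h1 ⟨x, h2⟩ = star u * Ψ.hom i h3 ⟨x, h4⟩ * u := by
    intro i
    by_cases hi : i ∈ T (κ i)
    · obtain ⟨h1, h2, h3⟩ := hi
      obtain ⟨u, hu, hu'⟩ := exists_unitary_of_mappingMatrix_eq (hasBlocks_starSubalgebra _)
        (hasBlocks _) h3
      exact ⟨u, hu, fun _ x hx _ _ _ _ => hu' ⟨x, hx⟩⟩
    · exact ⟨1, one_mem _, fun h => absurd h hi⟩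
  choose u hu1 hu2 using hex
  have hnorm : ∀ i, ‖u i‖ ≤ 1 := by
    intro i
    have h1 : ‖u i‖ * ‖u i‖ ≤ 1 := by
      rw [← CStarRing.norm_star_mul_self, Unitary.star_mul_self_of_mem (hu1 i)]
      exact norm_one_le
    nlinarith [norm_nonneg (u i)]
  let w : boundedFamilies B := ⟨u, 1, hnorm⟩
  have hw1 : star w * w = 1 :=
    Subtype.ext (funext fun i => Unitary.star_mul_self_of_mem (hu1 i))
  have hw2 : w * star w = 1 :=
    Subtype.ext (funext fun i => Unitary.mul_star_self_of_mem (hu1 i))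
  set W := Ultraproduct.mk U B w with hW
  have hW1 : star W * W = 1 := by rw [hW, Ultraproduct.star_mk, ← map_mul, hw1, map_one]
  have hW2 : W * star W = 1 := by rw [hW, Ultraproduct.star_mk, ← map_mul, hw2, map_one]
  let χ : A →⋆ₐ[ℂ] Ultraproduct U B :=
    { toFun := fun x => star W * ψ x * W
      map_one' := by rw [map_one, mul_one, hW1]
      map_mul' := fun x y => by
        have : star W * ψ x * W * (star W * ψ y * W) = star W * ψ x * (W * star W) * ψ y * W := by
          simp only [mul_assoc]
        rw [this, hW2, map_mul, mul_one]
        simp only [mul_assoc]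
      map_zero' := by simp
      map_add' := fun x y => by rw [map_add, mul_add, add_mul]
      commutes' := fun c => by
        rw [AlgHomClass.commutes, Algebra.algebraMap_eq_smul_one, mul_smul_comm, smul_mul_assoc,
          mul_one, hW1]
      map_star' := fun x => by simp [map_star, star_mul, mul_assoc] }
  have hφχ : φ = χ := by
    refine starAlgHom_eq_of_eqOn_dense hdense fun k x hx => ?_
    obtain ⟨y, hy1, hy2⟩ := Φ.lifts k x hx
    obtain ⟨z, hz1, hz2⟩ := Ψ.lifts k x hx
    change φ x = star W * ψ x * W
    rw [hy1, hz1, hW, Ultraproduct.star_mk, ← map_mul, ← map_mul, Ultraproduct.mk_eq_mk]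
    refine tendsto_const_nhds.congr' ?_
    filter_upwards [hκ1, hκ2 k, hy2, hz2] with i h1 h2 h3 h4
    obtain ⟨h5, h6, h7⟩ := h3
    obtain ⟨h8, h9, h10⟩ := h4
    have h11 := hu2 i h1 x (h𝒜 h2 hx) h5 h6 h8 h9
    rw [← h7, h11, h10]
    change _ = ‖star (u i) * z.1 i * u i - star (u i) * z.1 i * u i‖
    rw [sub_self, norm_zero]
  exact ⟨W, ⟨hW1, hW2⟩, fun x => by rw [hφχ]; rfl⟩

/-- Local lifts on the different `𝒜 k` need not extend one another, so all are compared with one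
linear lift `Y` of `φ`, with errors that vanish along the diagonal. -/
theorem nonempty_lifting [∀ k, FiniteDimensional ℂ (𝒜 k)]
    [∀ i, FiniteDimensional ℂ (B i)] (h𝒜 : Monotone 𝒜)
    (hU : ∃ S : ℕ → Set I, (∀ n, S n ∈ U) ∧ ⋂ n, S n = ∅) (φ : A →⋆ₐ[ℂ] Ultraproduct U B) :
    Nonempty (Lifting 𝒜 φ) := by
  classical
  -- A purely algebraic linear section suffices: only its values on bases of the `𝒜 j` are
  -- estimated.
  obtain ⟨L, hL⟩ := (Ultraproduct.mk U B).toLinearMap.exists_rightInverse_of_surjective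
    (LinearMap.range_eq_top.mpr (Ultraproduct.mk_surjective U B))
  let Y : A →ₗ[ℂ] boundedFamilies B := L.comp φ.toAlgHom.toLinearMap
  have hY : ∀ x, Ultraproduct.mk U B (Y x) = φ x := fun x => LinearMap.congr_fun hL (φ x)
  let b := fun j => Module.finBasis ℂ (𝒜 j)
  let T : ℕ → Set I := fun k => {i | ∃ Φ : 𝒜 k →⋆ₐ[ℂ] B i, ∀ j, ∀ hj : j ≤ k, ∀ t,
    ‖Φ ⟨b j t, h𝒜 hj (b j t).2⟩ - (Y (b j t)).1 i‖ ≤ 1 / ((k : ℝ) + 1)}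
  have hT : ∀ k, T k ∈ U := by
    intro k
    obtain ⟨Z, hZ1, hZ2⟩ := exists_local_lift (hasBlocks_starSubalgebra (𝒜 k))
      (φ.comp (𝒜 k).subtype)
    have h1 : ∀ᶠ i in (U : Filter I), ∀ j : Set.Iic k, ∀ t,
        ‖(Z ⟨b j t, h𝒜 j.2 (b j t).2⟩).1 i - (Y (b j t)).1 i‖ < 1 / ((k : ℝ) + 1) :=
      eventually_all.mpr fun j => eventually_all.mpr fun t =>
        eventually_norm_sub_lt (by rw [hZ1, hY]; rfl) (by positivity)
    filter_upwards [hZ2, h1] with i hi hi'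
    obtain ⟨Φ, hΦ⟩ := hi
    exact ⟨Φ, fun j hj t => by rw [hΦ]; exact (hi' ⟨j, hj⟩ t).le⟩
  obtain ⟨κ, hκ1, hκ2⟩ := exists_diagonal hU T hT
  choose Φ hΦ using fun i (hi : i ∈ {i | i ∈ T (κ i)}) => (hi : i ∈ T (κ i))
  refine ⟨Lifting.ofDiagonal h𝒜 φ hκ2 hκ1 Φ fun j x hx => ?_⟩
  rw [← hY, Ultraproduct.mk_eq_mk]
  -- Errors on basis vectors pass to `x` with the `ℓ¹` norm of its coordinates as factor.
  let C : ℝ := ∑ t, ‖(b j).repr ⟨x, hx⟩ t‖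
  have hlim : Tendsto (fun i => C * (1 / ((κ i : ℝ) + 1))) (U : Filter I) (𝓝 0) := by
    have hκ3 : Tendsto κ (U : Filter I) atTop := tendsto_atTop.mpr hκ2
    have := (tendsto_one_div_add_atTop_nhds_zero_nat (𝕜 := ℝ)).comp hκ3
    simpa using this.const_mul C
  refine squeeze_zero' (Eventually.of_forall fun i => norm_nonneg _) ?_ hlim
  filter_upwards [hκ1, hκ2 j] with i hi hji
  have hx' : x ∈ 𝒜 (κ i) := h𝒜 hji hx
  change ‖extendZero Φ i x - _‖ ≤ _
  rw [extendZero_apply Φ hi hx']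
  have h1 : x = ∑ t, (b j).repr ⟨x, hx⟩ t • (b j t : A) := by
    have := congrArg (𝒜 j).subtype ((b j).sum_repr ⟨x, hx⟩)
    simp only [map_sum, map_smul] at this
    exact this.symm
  have h2 : (⟨x, hx'⟩ : 𝒜 (κ i))
      = ∑ t, (b j).repr ⟨x, hx⟩ t • (⟨b j t, h𝒜 hji (b j t).2⟩ : 𝒜 (κ i)) := by
    apply Subtype.ext
    rw [AddSubmonoidClass.coe_finsetSum]
    exact h1
  have h3 : (Y x).1 i = ∑ t, (b j).repr ⟨x, hx⟩ t • (Y (b j t)).1 i := by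
    conv_lhs => rw [h1, map_sum]
    rw [AddSubmonoidClass.coe_finsetSum, Finset.sum_apply]
    refine Finset.sum_congr rfl fun t _ => ?_
    rw [map_smul]
    rfl
  rw [h2, h3, map_sum, ← Finset.sum_sub_distrib]
  refine (norm_sum_le _ _).trans ?_
  rw [Finset.sum_mul]
  refine Finset.sum_le_sum fun t _ => ?_
  rw [map_smul, ← smul_sub, norm_smul]
  exact mul_le_mul_of_nonneg_left (hΦ i hi j hji t) (norm_nonneg _)

/-- `p k` is an almost best approximation of `x` in `𝒜 k`; the slack `1 / (k + 1)` is needed since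
the infimum need not be chosen exactly. -/
theorem exists_approximants (h𝒜 : Monotone 𝒜) (hdense : Dense (⋃ k, (𝒜 k : Set A))) (x : A) :
    ∃ p : ℕ → A, (∀ k, p k ∈ 𝒜 k) ∧ Tendsto p atTop (𝓝 x) := by
  have hex : ∀ k : ℕ, ∃ z ∈ (𝒜 k : Set A), dist x z < Metric.infDist x (𝒜 k) + 1 / ((k : ℝ) + 1) :=
    fun k => (Metric.infDist_lt_iff ⟨0, zero_mem (𝒜 k)⟩).mp
      (lt_add_of_pos_right _ (by positivity))
  choose p hp1 hp2 using hex
  refine ⟨p, hp1, ?_⟩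
  rw [Metric.tendsto_nhds]
  intro ε hε
  obtain ⟨z, hz, hxz⟩ := Metric.mem_closure_iff.mp (hdense x) (ε / 2) (by positivity)
  obtain ⟨j, hj⟩ := Set.mem_iUnion.mp hz
  have hlim := (tendsto_one_div_add_atTop_nhds_zero_nat (𝕜 := ℝ)).eventually
    (gt_mem_nhds (show 0 < ε / 2 by positivity))
  filter_upwards [eventually_ge_atTop j, hlim] with k hk hk'
  have h1 : Metric.infDist x (𝒜 k) ≤ dist x z := Metric.infDist_le_dist_of_mem (h𝒜 hk hj)
  rw [dist_comm]
  linarith [hp2 k]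

/-- Send `x` to the class of `Φ i (p x (κ i))`. By contractivity any family `z i ∈ 𝒜 (κ i)`
converging to `x` gives the same class (`key`), so each algebraic identity follows by a suitable
choice of `z`. -/
theorem exists_starAlgHom_of_diagonal [∀ k, FiniteDimensional ℂ (𝒜 k)] (h𝒜 : Monotone 𝒜)
    (hdense : Dense (⋃ k, (𝒜 k : Set A))) {κ : I → ℕ}
    (hκ : ∀ j, ∀ᶠ i in (U : Filter I), j ≤ κ i) {s : Set I} (hs : s ∈ U)
    (Φ : ∀ i ∈ s, 𝒜 (κ i) →⋆ₐ[ℂ] B i) :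
    ∃ φ : A →⋆ₐ[ℂ] Ultraproduct U B,
      ∀ j, ∀ x ∈ 𝒜 j, Ultraproduct.mk U B (valueFamily Φ x) = φ x := by
  choose p hp1 hp2 using exists_approximants h𝒜 hdense
  have hκ' : Tendsto κ (U : Filter I) atTop := tendsto_atTop.mpr hκ
  let W : A → boundedFamilies B := fun x =>
    ⟨fun i => extendZero Φ i (p x (κ i)), by
      obtain ⟨C, hC⟩ := (hp2 x).norm.bddAbove_range
      exact ⟨C, fun i => (norm_extendZero_le Φ i _).trans (hC ⟨κ i, rfl⟩)⟩⟩
  have hWi : ∀ x, ∀ i (hi : i ∈ s), (W x).1 i = Φ i hi ⟨p x (κ i), hp1 x (κ i)⟩ := fun x i hi =>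
    extendZero_apply Φ hi _
  have key : ∀ (x : A) (z : I → A), Tendsto z (U : Filter I) (𝓝 x) → ∀ X : boundedFamilies B,
      (∀ᶠ i in (U : Filter I), ∃ (hi : i ∈ s) (hz : z i ∈ 𝒜 (κ i)), X.1 i = Φ i hi ⟨z i, hz⟩) →
      Ultraproduct.mk U B X = Ultraproduct.mk U B (W x) := by
    intro x z hz X hX
    rw [Ultraproduct.mk_eq_mk]
    have hlim : Tendsto (fun i => ‖z i - p x (κ i)‖) (U : Filter I) (𝓝 0) := by
      simpa using (hz.sub ((hp2 x).comp hκ')).norm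
    refine squeeze_zero' (Eventually.of_forall fun i => norm_nonneg _) ?_ hlim
    filter_upwards [hX] with i hi
    obtain ⟨hi, hzi, hXi⟩ := hi
    rw [hXi, hWi x i hi, ← map_sub]
    exact norm_starAlgHom_apply_le _ _
  refine ⟨
    { toFun := fun x => Ultraproduct.mk U B (W x)
      map_one' := ?_
      map_mul' := fun x y => ?_
      map_zero' := ?_
      map_add' := fun x y => ?_
      commutes' := fun c => ?_
      map_star' := fun x => ?_ }, fun j x hx => ?_⟩
  · rw [← map_one (Ultraproduct.mk U B)]
    refine (key 1 (fun _ => 1) tendsto_const_nhds 1 ?_).symm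
    filter_upwards [hs] with i hi
    exact ⟨hi, one_mem _, (map_one (Φ i hi)).symm⟩
  · rw [← map_mul]
    refine (key _ (fun i => p x (κ i) * p y (κ i)) (((hp2 x).comp hκ').mul ((hp2 y).comp hκ')) _
      ?_).symm
    filter_upwards [hs] with i hi
    refine ⟨hi, mul_mem (hp1 _ _) (hp1 _ _), ?_⟩
    change (W x).1 i * (W y).1 i = _
    rw [hWi x i hi, hWi y i hi, ← map_mul]
    rfl
  · rw [← map_zero (Ultraproduct.mk U B)]
    refine (key 0 (fun _ => 0) tendsto_const_nhds 0 ?_).symm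
    filter_upwards [hs] with i hi
    exact ⟨hi, zero_mem _, (map_zero (Φ i hi)).symm⟩
  · rw [← map_add]
    refine (key _ (fun i => p x (κ i) + p y (κ i)) (((hp2 x).comp hκ').add ((hp2 y).comp hκ')) _
      ?_).symm
    filter_upwards [hs] with i hi
    refine ⟨hi, add_mem (hp1 _ _) (hp1 _ _), ?_⟩
    change (W x).1 i + (W y).1 i = _
    rw [hWi x i hi, hWi y i hi, ← map_add]
    rfl
  · rw [← AlgHomClass.commutes (Ultraproduct.mk U B)]
    refine (key _ (fun _ => algebraMap ℂ A c) tendsto_const_nhds _ ?_).symm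
    filter_upwards [hs] with i hi
    exact ⟨hi, (𝒜 (κ i)).algebraMap_mem c, (AlgHomClass.commutes (Φ i hi) c).symm⟩
  · rw [Ultraproduct.star_mk]
    refine (key _ (fun i => star (p x (κ i))) ((hp2 x).comp hκ').star _ ?_).symm
    filter_upwards [hs] with i hi
    refine ⟨hi, star_mem (hp1 _ _), ?_⟩
    change star ((W x).1 i) = _
    rw [hWi x i hi, ← map_star]
    rfl
  · refine key x (fun _ => x) tendsto_const_nhds _ ?_
    filter_upwards [hs, hκ j] with i hi hji
    exact ⟨hi, h𝒜 hji hx, extendZero_apply Φ hi _⟩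

theorem exists_lifting_of_isCompatible [∀ k, FiniteDimensional ℂ (𝒜 k)]
    [∀ i, FiniteDimensional ℂ (B i)] (h𝒜 : Monotone 𝒜)
    (hdense : Dense (⋃ k, (𝒜 k : Set A)))
    (hU : ∃ S : ℕ → Set I, (∀ n, S n ∈ U) ∧ ⋂ n, S n = ∅) {Γ : InternalMatrixSeq 𝒜 U B}
    (hΓ : IsCompatible 𝒜 h𝒜 Γ) :
    ∃ (φ : A →⋆ₐ[ℂ] Ultraproduct U B) (Φ : Lifting 𝒜 φ), Φ.matrixSeq = Γ := by
  choose M hM using fun k => Quotient.mk''_surjective (Γ k)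
  have hdim : ∀ k, ∀ᶠ i in (U : Filter I), M k i *ᵥ dimVec (𝒜 k) = dimVec (B i) := by
    intro k
    have h := hΓ.mul_dim k
    rw [← hM] at h
    exact Quotient.exact' h
  have hinc : ∀ k, ∀ᶠ i in (U : Filter I),
      M (k + 1) i * mappingMatrix (StarSubalgebra.inclusion (h𝒜 (Nat.le_succ k))) = M k i := by
    intro k
    have h := hΓ.mul_inclusion k
    rw [← hM, ← hM] at h
    exact Quotient.exact' h
  -- The dimension equation is needed only at the top level, where the morphism is built; the
  -- inclusion equations transport it to all lower levels.
  let T : ℕ → Set I := fun k => {i | M k i *ᵥ dimVec (𝒜 k) = dimVec (B i) ∧ ∀ j < k,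
    M (j + 1) i * mappingMatrix (StarSubalgebra.inclusion (h𝒜 (Nat.le_succ j))) = M j i}
  have hT : ∀ k, T k ∈ U := by
    intro k
    have h1 : ∀ᶠ i in (U : Filter I), ∀ j : Set.Iio k, M (j + 1) i *
        mappingMatrix (StarSubalgebra.inclusion (h𝒜 (Nat.le_succ (j : ℕ)))) = M j i :=
      eventually_all.mpr fun j => hinc j
    filter_upwards [hdim k, h1] with i hi hi'
    exact ⟨hi, fun j hj => hi' ⟨j, hj⟩⟩
  obtain ⟨κ, hκ1, hκ2⟩ := exists_diagonal hU T hT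
  choose Φ hΦ using fun i (hi : i ∈ {i | i ∈ T (κ i)}) =>
    exists_mappingMatrix_eq (hasBlocks_starSubalgebra (𝒜 (κ i))) (hasBlocks (B i))
      (hi : i ∈ T (κ i)).1
  obtain ⟨φ, hφ⟩ := exists_starAlgHom_of_diagonal h𝒜 hdense hκ2 hκ1 Φ
  refine ⟨φ, Lifting.ofDiagonal h𝒜 φ hκ2 hκ1 Φ hφ, ?_⟩
  -- Descending induction from `κ i`: restricting from `𝒜 (j + 1)` to `𝒜 j` multiplies by the
  -- inclusion matrix, which is exactly the relation between `M (j + 1) i` and `M j i`.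
  have hrestrict : ∀ i (hi : i ∈ {i | i ∈ T (κ i)}) j (hj : j ≤ κ i),
      mappingMatrix ((Φ i hi).comp (StarSubalgebra.inclusion (h𝒜 hj))) = M j i := by
    intro i hi j hj
    induction hj using Nat.decreasingInduction with
    | self => exact hΦ i hi
    | of_succ j hj ih =>
      rw [← (hi : i ∈ T (κ i)).2 j hj, ← ih, ← mappingMatrix_comp (hasBlocks_starSubalgebra _)
        (hasBlocks_starSubalgebra _)]
      rfl
  funext k
  rw [← hM]
  refine Lifting.matrixSeq_eq_mk _ ?_
  filter_upwards [hκ1, hκ2 k] with i hi hki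
  exact ⟨⟨hi, h𝒜 hki⟩, hrestrict i hi k hki⟩

end Main

end AFUltra

end

/-! ### Assembly of the bijection. -/

theorem mainTheorem3 {A : Type*} [CStarAlgebra A] (𝒜 : ℕ → StarSubalgebra ℂ A)
    [∀ k, FiniteDimensional ℂ (𝒜 k)] (h𝒜 : Monotone 𝒜) (hdense : Dense (⋃ k, (𝒜 k : Set A)))
    {I : Type*} (U : Ultrafilter I)
    (hU : ∃ S : ℕ → Set I, (∀ n, S n ∈ U) ∧ ⋂ n, S n = ∅)
    (B : I → Type*) [∀ i, CStarAlgebra (B i)] [∀ i, FiniteDimensional ℂ (B i)] :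
    ∃ Λ : Quotient (AFUltra.innerConjSetoid A (AFUltra.Ultraproduct U B)) ≃
        {Γ : AFUltra.InternalMatrixSeq 𝒜 U B // AFUltra.IsCompatible 𝒜 h𝒜 Γ},
      ∀ (φ : A →⋆ₐ[ℂ] AFUltra.Ultraproduct U B) (Γ : AFUltra.InternalMatrixSeq 𝒜 U B),
        AFUltra.IsMatrixSeq 𝒜 φ Γ ↔ (Λ (Quotient.mk _ φ)).1 = Γ := by
  have hlift := fun φ => (AFUltra.nonempty_lifting (U := U) (B := B) h𝒜 hU φ).some
  let f : Quotient (AFUltra.innerConjSetoid A (AFUltra.Ultraproduct U B)) →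
      {Γ : AFUltra.InternalMatrixSeq 𝒜 U B // AFUltra.IsCompatible 𝒜 h𝒜 Γ} :=
    Quotient.lift (fun φ => ⟨(hlift φ).matrixSeq, (hlift φ).isCompatible h𝒜⟩) fun φ ψ h =>
      Subtype.ext ((hlift φ).matrixSeq_eq_of_innerConj h (hlift ψ))
  have hf : ∀ φ, (f (Quotient.mk _ φ)).1 = (hlift φ).matrixSeq := fun _ => rfl
  -- Makes the arbitrary choice of `hlift φ` immaterial.
  have huniq : ∀ φ (Φ Ψ : AFUltra.Lifting 𝒜 φ), Φ.matrixSeq = Ψ.matrixSeq := fun φ Φ Ψ =>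
    Φ.matrixSeq_eq_of_innerConj
      ((AFUltra.innerConjSetoid A (AFUltra.Ultraproduct U B)).refl φ) Ψ
  have hbij : Function.Bijective f := by
    constructor
    · rintro ⟨φ⟩ ⟨ψ⟩ h
      exact Quotient.sound (AFUltra.innerConj_of_matrixSeq_eq h𝒜 hdense hU (hlift φ) (hlift ψ)
        (congrArg Subtype.val h))
    · rintro ⟨Γ, hΓ⟩
      obtain ⟨φ, Φ, hΦ⟩ := AFUltra.exists_lifting_of_isCompatible h𝒜 hdense hU hΓ
      exact ⟨Quotient.mk _ φ, Subtype.ext ((huniq φ _ _).trans hΦ)⟩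
  refine ⟨Equiv.ofBijective f hbij, fun φ Γ => ?_⟩
  rw [Equiv.ofBijective_apply, hf]
  exact ⟨fun ⟨Φ, hΦ⟩ => (huniq φ _ _).trans hΦ, fun h => ⟨hlift φ, h⟩⟩
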